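/- **Setting.** Let $[0,R],[0,S],[0,T]$ carry open knot vectors (end knots of multiplicity exactly degree $+1$) of degrees $p^r,p^s,p^t\ge 1$ whose spline spaces are $C^1$ (interior knots of multiplicity at most degree $-1$). For an open knot vector $t_1\le\dots\le t_{n+p+1}$ let $B_1,\dots,B_n$ be the B-splines of degree $p$ and $D_j=\frac{p}{t_{j+p+1}-t_{j+1}}B^{p-1}_{j+1}$, $1\le j\le n-1$, where $B^{p-1}_{j+1}$ is the B-spline of degree $p-1$ with knots $t_{j+1},\dots,t_{j+p+1}$. With $(c_1,c_2)=\frac{(t_{n+p+1}-t_n,\;t_{p+2}-t_1)}{t_{n+p+1}-t_n+t_{p+2}-t_1}$, the $C^1$ periodic basis consists of the $n-2$ functions $H^{(0)}(B_1,\dots,B_n)^T$, $H^{(0)}=[c\,|\,I\,|\,c]$, $c=(c_1,0,\dots,0,c_2)^T$, and the periodic derivative basis of the $n-2$ functions $H^{(1)}(D_1,\dots,D_{n-1})^T$, where $H^{(1)}$ has last row $(c_2,0,\dots,0,c_1)$ and other rows $(0\,|\,I_{n-3}\,|\,0)$. In the directions $r,t$ use the periodic bases $B^r_i,D^r_i$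 ($1\le i\le n^r$), $B^t_k,D^t_k$ ($1\le k\le n^t$), in the direction $s$ the non-periodic ones $B^s_j$ ($1\le j\le n^s$), $D^s_j$ ($1\le j\le n^s-1$); the indices $i,k$ are cyclic. Put $\Omega=[0,R]\times[0,S]\times[0,T]$; let $\mathbf B^{(0,1,1)},\mathbf B^{(1,0,1)},\mathbf B^{(1,1,0)},\mathbf B^{(1,1,1)}$ be the families of products $B^r_iD^s_jD^t_k$, $D^r_iB^s_jD^t_k$, $D^r_iD^s_jB^t_k$, $D^r_iD^s_jD^t_k$; let $X_2$ be the product of the spans of the first three and $X_3$ the span of the last. Let $\theta_i=2\pi+\frac{(1-2i)\pi}{n^r}$, $\varphi_k=2\pi+\frac{(1-2k)\pi}{n^t}$, $\rho_j=\frac{j-1}{n^s-1}$, $\bar\rho>2$. The polar map is $F=\sum_{i,j,k}\mathbf F_{ijk}B^r_iB^s_jB^t_k$ on $\Omega$ with $\mathbf F_{ijk}=((\bar\rho+\rho_j\cos\theta_i)\cos\varphi_k,(\bar\rho+\rho_j\cos\theta_i)\sin\varphi_k,\rho_j\sin\theta_i)$; $\Omega^{pol}=F(\Omega)$, and $F(\{s=0\})$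 is the polar curve. Let $\bar E_{\ell,(i,1)}=\frac13$ and $\bar E_{\ell,(i,2)}=\frac13+(A(\cos\theta_i,\sin\theta_i)^T)_\ell$, where $A$ has rows $(\frac13,0),(-\frac16,\frac{\sqrt3}6),(-\frac16,-\frac{\sqrt3}6)$; $\bar E_{\ell,(\Delta i,2)}=\bar E_{\ell,(i+1,2)}-\bar E_{\ell,(i,2)}$. **Reduced spaces.** The degrees of freedom of $V_2$ are, for each $k$: faces $f_{jik}$ ($1\le j\le n^s-2$, $1\le i\le n^r$), two special ones $\sigma_{1k},\sigma_{2k}$, radial ones $a_{jik}$ and poloidal ones $b_{jik}$ ($j,i$ as before). The transposed restriction matrices map $\mathbf h=(f,\sigma,a,b)$ to the coefficients $$h^1_{i1k}=\sum_{\ell=1}^2(\bar E_{\ell+1,(i,2)}-\bar E_{\ell+1,(i,1)})\sigma_{\ell k},\quad h^1_{ijk}=a_{(j-1)ik}\ (j\ge2),$$ $$h^2_{i1k}=0,\quad h^2_{i2k}=-\sum_{\ell=1}^2\bar E_{\ell+1,(\Delta i,2)}\sigma_{\ell k},\quad h^2_{ijk}=-b_{(j-2)ik}\ (j\ge 3),$$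 $$h^3_{i1k}=0,\quad h^3_{ijk}=f_{(j-1)ik}\ (j\ge2);$$ the corresponding matrices (rows indexed by $\mathbf h$) are $E^{(0,1,1)},E^{(1,0,1)},E^{(1,1,0)}$. Similarly $E^{(1,1,1)T}$ maps $\mathbf m=(m_{jik})$, $1\le j\le n^s-2$, to $\bar m_{i1k}=0$, $\bar m_{ijk}=m_{(j-1)ik}$ ($j\ge2$). Let $N^{(2)}_\ell$ be the vector fields with components $(E^{(0,1,1)}\mathbf B^{(0,1,1)})_\ell,(E^{(1,0,1)}\mathbf B^{(1,0,1)})_\ell,(E^{(1,1,0)}\mathbf B^{(1,1,0)})_\ell$, $N^{(3)}_\ell=(E^{(1,1,1)}\mathbf B^{(1,1,1)})_\ell$, $V_2=\mathrm{span}\{N^{(2)}_\ell\}\subseteq X_2$, $V_3=\mathrm{span}\{N^{(3)}_\ell\}\subseteq X_3$. Let $D^{(2)}$ be the polar divergence matrix $\mathbf h\mapsto\mathbf m$, $$m_{jik}=a_{j(i+1)k}-a_{jik}-b_{jik}+\beta_{jik}+f_{ji(k+1)}-f_{jik},\qquad \beta_{1ik}=\sum_{\ell=1}^2\bar E_{\ell+1,(\Delta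 i,2)}\sigma_{\ell k},\ \ \beta_{jik}=b_{(j-1)ik}\ (j\ge2).$$ A linear operator $\mathcal E^2:X_2\to V_2$ is called an extraction operator if it maps the field with coefficients $(E^{(0,1,1)T}\mathbf h,E^{(1,0,1)T}\mathbf h,E^{(1,1,0)T}\mathbf h)$ to $\mathbf N^{(2)}\cdot\mathbf h$ for all $\mathbf h$; a linear operator $\mathcal E^3:X_3\to V_3$, if it maps the function with coefficients $E^{(1,1,1)T}\mathbf m$ to $\mathbf N^{(3)}\cdot\mathbf m$ for all $\mathbf m$. **Corollary.** (Divergences are classical, one-sided at the boundary of $\Omega$.) 1. Every field in $X_2$ with coefficients $(h^1,h^2,h^3)$ has divergence on $\Omega$ in $X_3$, with coefficients $h^1_{(i+1)jk}-h^1_{ijk}+h^2_{i(j+1)k}-h^2_{ijk}+h^3_{ij(k+1)}-h^3_{ijk}$; i.e. it has the matrix form $D^{(1,0,0)}h^1+D^{(0,1,0)}h^2+D^{(0,0,1)}h^3$. 2. The extraction matrices commute with the divergence: $D^{(1,0,0)}E^{(0,1,1)T}\mathbf h+D^{(0,1,0)}E^{(1,0,1)T}\mathbf h+D^{(0,0,1)}E^{(1,1,0)T}\mathbf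 h=E^{(1,1,1)T}D^{(2)}\mathbf h$ for all $\mathbf h$. 3. For every $\mathbf h$ the element $\mathbf N^{(2)}\cdot\mathbf h$ of $V_2$ is the tensor field with coefficients $(E^{(0,1,1)T}\mathbf h,E^{(1,0,1)T}\mathbf h,E^{(1,1,0)T}\mathbf h)$, the element $\mathbf N^{(3)}\cdot D^{(2)}\mathbf h$ of $V_3$ is the tensor function with coefficients $E^{(1,1,1)T}D^{(2)}\mathbf h$, and $\mathrm{div}(\mathbf N^{(2)}\cdot\mathbf h)=\mathbf N^{(3)}\cdot D^{(2)}\mathbf h$ on $\Omega$; thus $\mathrm{div}\,V_2\subseteq V_3$. 4. Extraction operators $\mathcal E^3:X_3\to V_3$ exist, and for each of them there is an extraction operator $\mathcal E^2:X_2\to V_2$ with $\mathrm{div}\circ\mathcal E^2=\mathcal E^3\circ\mathrm{div}$ on $X_2$. 5. Suppose that $F$ is a regular parametrization away from the polar curve: $F$ is injective on $[0,R)\times(0,S]\times[0,T)$ and $\det DF\ne0$ on $[0,R]\times(0,S]\times[0,T]$. Then for every $\ell$ the pushforward $\mathcal F^3(N^{(3)}_\ell)=((\det DF)^{-1}N^{(3)}_\ell)\circ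 F^{-1}$ is well defined (independently of the choice of preimage) and bounded on $\Omega^{pol}$ away from the polar curve, that is, on $F(\{x\in\Omega: s>0\})$. -/

import Mathlib

open Set Matrix
open scoped Matrix Kronecker

noncomputable section

namespace PolarSplines

/-- Points of the parameter space, with coordinates `x 0 = r`, `x 1 = s`, `x 2 = t`, and of the
physical space, with coordinates `u, v, w`. -/
abbrev Pt := Fin 3 → ℝ

/-! ### Univariate splines -/

/-- An open knot vector on `[0, L]` whose splines of degree `p` are `C¹`. The number of B-splines is
`n = m + 2`, and the knots (indexed from `0`) are `t 0, …, t (n + p)`; for convenience the sequence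
is continued by its last value. The end knots have multiplicity exactly `p + 1`, interior knots have
multiplicity at most `p - 1`. -/
structure C1Knots where
  L : ℝ
  p : ℕ
  m : ℕ
  t : ℕ → ℝ
  one_le_p : 1 ≤ p
  p_lt : p < m + 2
  mono : Monotone t
  first : ∀ i ≤ p, t i = 0
  last : ∀ i, m + 2 ≤ i → t i = L
  first_lt : 0 < t (p + 1)
  lt_last : t (m + 1) < L
  mult : ∀ i, p < i → i + p - 1 < m + 2 → t i < t (i + p - 1)

/-- The B-spline of degree `p` starting at the knot `t i` (Cox - de Boor recursion, with the
convention `0 / 0 = 0`); the last nonempty knot interval, ending at `L`, is closed. -/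
def bspline (t : ℕ → ℝ) (L : ℝ) : ℕ → ℕ → ℝ → ℝ
  | 0, i, x =>
      open Classical in
      if (t i ≤ x ∧ x < t (i + 1)) ∨ (t i < t (i + 1) ∧ t (i + 1) = L ∧ x = L) then 1 else 0
  | p + 1, i, x =>
      (x - t i) / (t (i + p + 1) - t i) * bspline t L p i x +
        (t (i + p + 2) - x) / (t (i + p + 2) - t (i + 1)) * bspline t L p (i + 1) x

namespace C1Knots

variable (κ : C1Knots)

/-- The B-splines of degree `p`. -/
def B (j : Fin (κ.m + 2)) (x : ℝ) : ℝ := bspline κ.t κ.L κ.p j x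

/-- The scaled B-splines of degree `p - 1`, in which derivatives of splines are expanded. -/
def D (j : Fin (κ.m + 1)) (x : ℝ) : ℝ :=
  (κ.p : ℝ) / (κ.t (j + κ.p + 1) - κ.t (j + 1)) * bspline κ.t κ.L (κ.p - 1) (j + 1) x

def c₁ : ℝ :=
  (κ.t (κ.m + 2 + κ.p) - κ.t (κ.m + 1)) /
    (κ.t (κ.m + 2 + κ.p) - κ.t (κ.m + 1) + κ.t (κ.p + 1) - κ.t 0)

def c₂ : ℝ :=
  (κ.t (κ.p + 1) - κ.t 0) /
    (κ.t (κ.m + 2 + κ.p) - κ.t (κ.m + 1) + κ.t (κ.p + 1) - κ.t 0)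

/-- The matrix `[c | I | c]` with `c = (c₁, 0, …, 0, c₂)ᵀ`. -/
def H₀ : Matrix (Fin κ.m) (Fin (κ.m + 2)) ℝ := Matrix.of fun i j =>
  (if (j : ℕ) = i + 1 then 1 else 0) +
    (if (j : ℕ) = 0 ∨ (j : ℕ) = κ.m + 1 then
      (if (i : ℕ) = 0 then κ.c₁ else 0) + (if (i : ℕ) + 1 = κ.m then κ.c₂ else 0)
    else 0)

/-- The matrix whose last row is `(c₂, 0, …, 0, c₁)` and whose other rows are `(0 | I | 0)`. -/
def H₁ : Matrix (Fin κ.m) (Fin (κ.m + 1)) ℝ := Matrix.of fun i j =>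
  if (i : ℕ) + 1 = κ.m then
    (if (j : ℕ) = 0 then κ.c₂ else 0) + (if (j : ℕ) = κ.m then κ.c₁ else 0)
  else if (j : ℕ) = i + 1 then 1 else 0

/-- The `C¹` periodic basis functions; there are `m` of them. -/
def Bper (i : Fin κ.m) (x : ℝ) : ℝ := ∑ j, κ.H₀ i j * κ.B j x

/-- The `C⁰` periodic functions in which derivatives of periodic splines are expanded. -/
def Dper (i : Fin κ.m) (x : ℝ) : ℝ := ∑ j, κ.H₁ i j * κ.D j x

end C1Knots

/-- The `q × (q + 1)` difference matrix. -/
def diff (q : ℕ) : Matrix (Fin q) (Fin (q + 1)) ℝ := Matrix.of fun i j =>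
  (if j = i.succ then 1 else 0) - (if j = i.castSucc then 1 else 0)

/-- The `q × q` cyclic difference matrix. -/
def diffPer (q : ℕ) : Matrix (Fin q) (Fin q) ℝ := Matrix.of fun i j =>
  (if j = finRotate q i then 1 else 0) - (if j = i then 1 else 0)

/-! ### The tensor product setting -/

/-- Knot vectors in the directions `r`, `s`, `t` and the major radius `ρ`. The splines in the
directions `r` and `t` are periodic, those in the direction `s` are not. -/
structure Setting where
  kr : C1Knots
  ks : C1Knots
  kt : C1Knots
  ρ : ℝ
  two_lt : 2 < ρ

namespace Setting

variable (P : Setting)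

/-- The numbers `nʳ` and `nᵗ` of basis functions; the number `nˢ` is `ms + 2`. -/
abbrev nr : ℕ := P.kr.m
abbrev ms : ℕ := P.ks.m
abbrev nt : ℕ := P.kt.m

/-- The lengths of the sides of the parameter domain. -/
def len : Fin 3 → ℝ := ![P.kr.L, P.ks.L, P.kt.L]

/-- The parameter domain `Ω = [0, R] × [0, S] × [0, T]`. -/
def Ω : Set Pt := {x | ∀ a, x a ∈ Icc 0 (P.len a)}

/-- The parameter domain without the side `s = 0` that is collapsed to the polar curve. -/
def Ωpos : Set Pt := {x | x ∈ P.Ω ∧ 0 < x 1}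

/-- Multi-indices `(k, (j, i))` of the tensor product bases, `j` ranging over `nˢ`
respectively `nˢ - 1` values; the order of the factors is that of the Kronecker products. -/
abbrev Idx : Type := Fin P.nt × (Fin (P.ms + 2) × Fin P.nr)
abbrev Idx' : Type := Fin P.nt × (Fin (P.ms + 1) × Fin P.nr)

def B000 (a : P.Idx) (x : Pt) : ℝ := P.kr.Bper a.2.2 (x 0) * P.ks.B a.2.1 (x 1) * P.kt.Bper a.1 (x 2)
def B011 (a : P.Idx') (x : Pt) : ℝ := P.kr.Bper a.2.2 (x 0) * P.ks.D a.2.1 (x 1) * P.kt.Dper a.1 (x 2)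
def B101 (a : P.Idx) (x : Pt) : ℝ := P.kr.Dper a.2.2 (x 0) * P.ks.B a.2.1 (x 1) * P.kt.Dper a.1 (x 2)
def B110 (a : P.Idx') (x : Pt) : ℝ := P.kr.Dper a.2.2 (x 0) * P.ks.D a.2.1 (x 1) * P.kt.Bper a.1 (x 2)
def B111 (a : P.Idx') (x : Pt) : ℝ := P.kr.Dper a.2.2 (x 0) * P.ks.D a.2.1 (x 1) * P.kt.Dper a.1 (x 2)

/-- The vector field `(B011 · h₁, B101 · h₂, B110 · h₃)`. -/
def tensorField (h₁ : P.Idx' → ℝ) (h₂ : P.Idx → ℝ) (h₃ : P.Idx' → ℝ) : Fin 3 → Pt → ℝ :=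
  ![fun x => ∑ a, h₁ a * P.B011 a x, fun x => ∑ a, h₂ a * P.B101 a x,
    fun x => ∑ a, h₃ a * P.B110 a x]

/-- The function `B111 · m`. -/
def tensorFun (m : P.Idx' → ℝ) : Pt → ℝ := fun x => ∑ a, m a * P.B111 a x

/-- The tensor spline space of vector fields on which the divergence acts. -/
def X₂ : Submodule ℝ (Fin 3 → Pt → ℝ) :=
  Submodule.pi Set.univ ![Submodule.span ℝ (range P.B011), Submodule.span ℝ (range P.B101),
    Submodule.span ℝ (range P.B110)]

/-- The tensor spline space that contains the divergences. -/
def X₃ : Submodule ℝ (Pt → ℝ) := Submodule.span ℝ (range P.B111)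

/-- The difference matrices in the directions `r`, `s`, `t`, acting on the coefficients of the
respective components of a vector field. -/
def D100 : Matrix P.Idx' P.Idx' ℝ := 1 ⊗ₖ (1 ⊗ₖ diffPer P.nr)
def D010 : Matrix P.Idx' P.Idx ℝ := 1 ⊗ₖ (diff (P.ms + 1) ⊗ₖ 1)
def D001 : Matrix P.Idx' P.Idx' ℝ := diffPer P.nt ⊗ₖ (1 ⊗ₖ 1)

/-- `g` is the divergence of the vector field `h` on `Ω`: at each point of `Ω` the three partial
derivatives (one-sided at the boundary) exist and their sum is the value of `g`. -/
def HasDiv (h : Fin 3 → Pt → ℝ) (g : Pt → ℝ) : Prop :=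
  ∃ d : Fin 3 → Pt → ℝ, ∀ x ∈ P.Ω,
    (∀ a, HasDerivWithinAt (fun y => h a (Function.update x a y)) (d a x)
      (Icc 0 (P.len a)) (x a)) ∧ g x = ∑ a, d a x

/-! ### The polar map and the pushforward -/

/-- The angles `2π + (1 - 2i)π/n`, `i = 1, …, n`. -/
def angle {n : ℕ} (i : Fin n) : ℝ :=
  2 * Real.pi + (1 - 2 * ((i : ℝ) + 1)) * Real.pi / n

/-- The radii `(j - 1)/(nˢ - 1)`, `j = 1, …, nˢ`. -/
def radius (j : Fin (P.ms + 2)) : ℝ := (j : ℝ) / ((P.ms : ℝ) + 1)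

/-- The control points of the polar map. -/
def control (a : P.Idx) : Pt :=
  ![(P.ρ + P.radius a.2.1 * Real.cos (angle a.2.2)) * Real.cos (angle a.1),
    (P.ρ + P.radius a.2.1 * Real.cos (angle a.2.2)) * Real.sin (angle a.1),
    P.radius a.2.1 * Real.sin (angle a.2.2)]

/-- The polar map. -/
def F (x : Pt) : Pt := ∑ a, P.B000 a x • P.control a

/-- The Jacobian matrix of the polar map on `Ω`. -/
def DF (x : Pt) : Matrix (Fin 3) (Fin 3) ℝ := Matrix.of fun b a =>
  derivWithin (fun y => P.F (Function.update x a y) b) (Icc 0 (P.len a)) (x a)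

/-- Away from the polar curve the polar map is a regular parametrization of the solid torus: up to
the identification of `r = 0` with `r = R` and of `t = 0` with `t = T` it is injective, and its
Jacobian determinant does not vanish. -/
def IsRegular : Prop :=
  InjOn P.F {x | x ∈ P.Ωpos ∧ x 0 < P.len 0 ∧ x 2 < P.len 2} ∧
    ∀ x ∈ P.Ωpos, (P.DF x).det ≠ 0

/-- The pushforward `((det DF)⁻¹ φ) ∘ F⁻¹`, a function on the solid torus without the polar curve,
which is the image of `Ωpos`. -/
def pushforward₃ (φ : Pt → ℝ) (y : Pt) : ℝ :=
  ((P.DF (Function.invFunOn P.F P.Ωpos y)).det)⁻¹ * φ (Function.invFunOn P.F P.Ωpos y)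

/-! ### Extraction matrices and reduced spaces -/

/-- The second column block of the `3 × 2nʳ` polar extraction block `Ē`; all entries of the
first column block are `1/3`. -/
def Ebar₂ (l : Fin 3) (i : Fin P.nr) : ℝ :=
  1 / 3 + ((!![1 / 3, 0; -1 / 6, Real.sqrt 3 / 6; -1 / 6, -Real.sqrt 3 / 6] :
    Matrix (Fin 3) (Fin 2) ℝ) *ᵥ ![Real.cos (angle i), Real.sin (angle i)]) l

def Ebar₁ (_l : Fin 3) (_i : Fin P.nr) : ℝ := 1 / 3

/-- `Ē_{l,(i+1,2)} - Ē_{l,(i,2)}`, cyclically in `i`. -/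
def ΔEbar₂ (l : Fin 3) (i : Fin P.nr) : ℝ := P.Ebar₂ l (finRotate P.nr i) - P.Ebar₂ l i

/-- Index set with `n̄₁ = 2 + 2nʳ(nˢ - 2)` elements: two special indices, then for each of the
`nˢ - 2` values of `j` a round `(j, 0, ·)` of `nʳ` radial and a round `(j, 1, ·)` of `nʳ` poloidal
indices. -/
abbrev J₁ : Type := Fin 2 ⊕ (Fin P.ms × (Fin 2 × Fin P.nr))

/-- Index set with `n̄₂ = nʳ(nˢ - 2)` elements. -/
abbrev J₂ : Type := Fin P.ms × Fin P.nr

def E10 : Matrix P.J₁ (Fin (P.ms + 2) × Fin P.nr) ℝ := Matrix.of fun y x =>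
  match y with
  | .inl l => if (x.1 : ℕ) = 1 then P.ΔEbar₂ l.succ x.2 else 0
  | .inr (j, e, i) => if e = 1 ∧ (x.1 : ℕ) = j + 2 ∧ x.2 = i then 1 else 0

def E01 : Matrix P.J₁ (Fin (P.ms + 1) × Fin P.nr) ℝ := Matrix.of fun y x =>
  match y with
  | .inl l => if (x.1 : ℕ) = 0 then P.Ebar₂ l.succ x.2 - P.Ebar₁ l.succ x.2 else 0
  | .inr (j, e, i) => if e = 0 ∧ (x.1 : ℕ) = j + 1 ∧ x.2 = i then 1 else 0

/-- The matrix `[O | I]`. -/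
def E2 : Matrix P.J₂ (Fin (P.ms + 1) × Fin P.nr) ℝ := Matrix.of fun y x =>
  if x.1 = y.1.succ ∧ x.2 = y.2 then 1 else 0

/-- Index sets of the bases of `V₂` and `V₃`, with `n₂ = nᵗ(n̄₂ + n̄₁)` and `n₃ = nᵗn̄₂` elements. -/
abbrev I₂ : Type := Fin P.nt × (P.J₂ ⊕ P.J₁)
abbrev I₃ : Type := Fin P.nt × P.J₂

def E011 : Matrix P.I₂ P.Idx' ℝ := 1 ⊗ₖ Matrix.fromRows 0 P.E01
def E101 : Matrix P.I₂ P.Idx ℝ := 1 ⊗ₖ Matrix.fromRows 0 (-P.E10)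
def E110 : Matrix P.I₂ P.Idx' ℝ := 1 ⊗ₖ Matrix.fromRows P.E2 0
def E111 : Matrix P.I₃ P.Idx' ℝ := 1 ⊗ₖ P.E2

/-- The generators `(E011 B011, E101 B101, E110 B110)` of `V₂`. -/
def N₂ (l : P.I₂) : Fin 3 → Pt → ℝ :=
  ![fun x => ∑ a, P.E011 l a * P.B011 a x, fun x => ∑ a, P.E101 l a * P.B101 a x,
    fun x => ∑ a, P.E110 l a * P.B110 a x]

/-- The generators `E111 B111` of `V₃`. -/
def N₃ (l : P.I₃) : Pt → ℝ := fun x => ∑ a, P.E111 l a * P.B111 a x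

def V₂ : Submodule ℝ (Fin 3 → Pt → ℝ) := Submodule.span ℝ (range P.N₂)

def V₃ : Submodule ℝ (Pt → ℝ) := Submodule.span ℝ (range P.N₃)

/-- The action of the divergence on the degrees of freedom of `V₂`: sum of the (oriented) faces
that enclose a volume of the polygonal ring, with the two special faces in place of the inner face
for the innermost round of volumes. -/
def polarDiv (h : P.I₂ → ℝ) (v : P.I₃) : ℝ :=
  let k := v.1
  let j := v.2.1
  let i := v.2.2
  let rad : Fin P.ms → Fin P.nr → ℝ := fun j i => h (k, .inr (.inr (j, 0, i)))
  let pol : Fin P.ms → Fin P.nr → ℝ := fun j i => h (k, .inr (.inr (j, 1, i)))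
  rad j (finRotate P.nr i) - rad j i - pol j i +
    (if (j : ℕ) = 0 then ∑ l : Fin 2, P.ΔEbar₂ l.succ i * h (k, .inr (.inl l))
      else pol ⟨(j : ℕ) - 1, lt_of_le_of_lt (Nat.sub_le _ _) j.isLt⟩ i) +
    h (finRotate P.nt k, .inl (j, i)) - h (k, .inl (j, i))

/-- The tensor field whose degrees of freedom are obtained from those of an element of `V₂` by the
transposed restriction matrices. -/
def restrictedField (h : P.I₂ → ℝ) : Fin 3 → Pt → ℝ :=
  P.tensorField (P.E011ᵀ *ᵥ h) (P.E101ᵀ *ᵥ h) (P.E110ᵀ *ᵥ h)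

def restrictedFun (m : P.I₃ → ℝ) : Pt → ℝ := P.tensorFun (P.E111ᵀ *ᵥ m)

/-- A linear operator from the tensor space onto `V₂` is an extraction operator if it sends each
tensor field whose degrees of freedom come from `h` through the transposed restriction matrices
to the element of `V₂` with degrees of freedom `h`. -/
def IsExtraction₂ (ε : P.X₂ →ₗ[ℝ] P.V₂) : Prop :=
  ∀ (h : P.I₂ → ℝ) (f : P.X₂), (f : Fin 3 → Pt → ℝ) = P.restrictedField h →
    (ε f : Fin 3 → Pt → ℝ) = ∑ l, h l • P.N₂ l

def IsExtraction₃ (ε : P.X₃ →ₗ[ℝ] P.V₃) : Prop :=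
  ∀ (m : P.I₃ → ℝ) (f : P.X₃), (f : Pt → ℝ) = P.restrictedFun m →
    (ε f : Pt → ℝ) = ∑ l, m l • P.N₃ l

end Setting

end PolarSplines

end

/-! The analytic input is univariate. The bound on knot multiplicities makes the one-sided
derivatives of a B-spline agree at the knots (`hasDerivWithinAt_bspline`), and differentiating a
spline turns its coefficients into differences: plain ones in `s` (`hasDerivWithinAt_B`), cyclic
ones for the periodic bases (`hasDerivWithinAt_Bper`). The divergence is therefore a sum of
difference matrices acting on coefficients (`hasDiv_tensorField`), and its compatibility with the
extraction matrices is a finite computation (`coefficients_commute`). In the innermost row the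
special faces enter the radial and the poloidal differences with opposite signs and cancel.

Extraction operators are precisely the linear projections of the tensor spaces onto the reduced ones
(`isExtraction₂_iff`, `isExtraction₃_iff`), so they exist. Let `π` be any projection onto `V₂`, and
let `R` be a linear right inverse of the divergence `V₂ → V₃`, obtained by summing the prescribed
volumes outwards in `s`. Then `ε₂ = π + R ∘ ε₃ ∘ div ∘ (1 - π)` is again a projection. It commutes
with the divergence because `ε₃` fixes `div V₂ ⊆ V₃`.

For the pushforwards, `det DF` factors as `radial` times `reducedJacobian` (`det_DF`). Regularity
forces the second factor to be nonzero on all of `Ω`, the side `s = 0` included, hence bounded away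
from zero by compactness. The first factor is at least a constant times `s`, and each generator of
`V₃` is at most a constant times `s`, since the only spline in `s` that does not vanish at `0` is
left out. So the quotient is bounded. It does not depend on the preimage because all ingredients are
periodic in `r` and `t`. -/

noncomputable section

open Filter Topology

namespace PolarSplines

/-! ### Polynomial pieces of B-splines -/

/-- The polynomial that the B-spline of degree `p` starting at `t i` equals on `[t k, t (k + 1))`. -/
def piece (t : ℕ → ℝ) (k : ℕ) : ℕ → ℕ → ℝ → ℝ
  | 0, i, _ => if i = k then 1 else 0
  | p + 1, i, x =>
      (x - t i) / (t (i + p + 1) - t i) * piece t k p i x +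
        (t (i + p + 2) - x) / (t (i + p + 2) - t (i + 1)) * piece t k p (i + 1) x

section Pieces

variable {t : ℕ → ℝ} {L x : ℝ} {k : ℕ}

theorem bspline_eq_piece (ht : Monotone t) (hk : t k ≤ x) (hk' : x < t (k + 1)) (hx : x ≠ L)
    (p i : ℕ) : bspline t L p i x = piece t k p i x := by
  induction p generalizing i with
  | zero =>
    have : (t i ≤ x ∧ x < t (i + 1)) ↔ i = k := by
      refine ⟨fun h => ?_, fun h => h ▸ ⟨hk, hk'⟩⟩
      have h1 : i < k + 1 := ht.reflect_lt (h.1.trans_lt hk')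
      have h2 : k < i + 1 := ht.reflect_lt (hk.trans_lt h.2)
      omega
    simp [bspline, piece, this, hx]
  | succ p ih => simp only [bspline, piece, ih]

theorem bspline_last_eq_piece (ht : Monotone t) (hL : ∀ i, t i ≤ L) (hk : t k < L)
    (hk' : t (k + 1) = L) (p i : ℕ) : bspline t L p i L = piece t k p i L := by
  induction p generalizing i with
  | zero =>
    have : (t i ≤ L ∧ L < t (i + 1) ∨ t i < t (i + 1) ∧ t (i + 1) = L ∧ L = L) ↔ i = k := by
      refine ⟨fun h => ?_, fun h => Or.inr (h ▸ ⟨hk' ▸ hk, hk', rfl⟩)⟩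
      rcases h with h | h
      · exact absurd h.2 (hL _).not_gt
      · have h1 : i < k + 1 := ht.reflect_lt (by rw [hk', ← h.2.1]; exact h.1)
        have h2 : k < i + 1 := ht.reflect_lt (by rw [h.2.1]; exact hk)
        omega
    simp only [bspline, piece]
    exact if_congr (by simpa using this) rfl rfl
  | succ p ih => simp only [bspline, piece, ih]

/-- The classical derivative formula holds for the formal recursion itself: induction on the degree,
with the product rule applied to the two linear weights. The convention `x / 0 = 0` covers
coincident knots. -/
theorem hasDerivAt_piece (ht : Monotone t) (k p i : ℕ) (x : ℝ) :
    HasDerivAt (piece t k (p + 1) i)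
      ((p + 1 : ℝ) / (t (i + p + 1) - t i) * piece t k p i x -
        (p + 1 : ℝ) / (t (i + p + 2) - t (i + 1)) * piece t k p (i + 1) x) x := by
  have h1 : ∀ a b : ℝ, HasDerivAt (fun y => (y - a) / b) (1 / b) x := fun a b =>
    ((hasDerivAt_id x).sub_const a).div_const b
  have h2 : ∀ a b : ℝ, HasDerivAt (fun y => (a - y) / b) (-1 / b) x := fun a b =>
    ((hasDerivAt_id x).const_sub a).div_const b
  induction p generalizing i with
  | zero =>
    have := ((h1 (t i) (t (i + 0 + 1) - t i)).mul_const (piece t k 0 i x)).add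
      ((h2 (t (i + 0 + 2)) (t (i + 0 + 2) - t (i + 1))).mul_const (piece t k 0 (i + 1) x))
    refine this.congr_deriv ?_
    push_cast
    ring
  | succ p ih =>
    have := ((h1 (t i) (t (i + (p + 1) + 1) - t i)).mul (ih i)).add
      ((h2 (t (i + (p + 1) + 2)) (t (i + (p + 1) + 2) - t (i + 1))).mul (ih (i + 1)))
    refine this.congr_deriv ?_
    simp only [piece, show i + 1 + p + 1 = i + p + 2 by ring, show i + 1 + p + 2 = i + p + 3 by ring,
      show i + (p + 1) + 1 = i + p + 2 by ring, show i + (p + 1) + 2 = i + p + 3 by ring,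
      show i + 1 + 1 = i + 2 by ring]
    push_cast
    generalize piece t k p i x = u
    generalize piece t k p (i + 1) x = v
    generalize piece t k p (i + 2) x = w
    -- The terms in `u` and `w` match as they stand, whatever their outer inverses are. Only the
    -- terms in `v` need a relation between denominators: the two weights over each of the wider
    -- knot spans add up to `1`. If the middle span is empty, these terms drop out.
    by_cases h : t (i + p + 2) - t (i + 1) = 0
    · simp only [h, div_zero, zero_mul, sub_zero, add_zero, zero_add, zero_sub]
      ring
    · have h01 : t i ≤ t (i + 1) := ht (by omega)
      have h12 : t (i + 1) ≤ t (i + p + 2) := ht (by omega)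
      have h23 : t (i + p + 2) ≤ t (i + p + 3) := ht (by omega)
      have hlt : t (i + 1) < t (i + p + 2) := lt_of_le_of_ne h12 fun e => h (by rw [e, sub_self])
      have e1 : t (i + p + 2) - t i ≠ 0 := by linarith [sub_pos.2 (h01.trans_lt hlt)] |> fun
        (h : 0 < t (i + p + 2) - t i) => h.ne'
      have e2 : t (i + p + 3) - t (i + 1) ≠ 0 := (sub_pos.2 (hlt.trans_le h23)).ne'
      simp only [div_eq_mul_inv]
      generalize (t (i + p + 1) - t i)⁻¹ = α
      generalize (t (i + p + 3) - t (i + 2))⁻¹ = β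
      field_simp
      ring

theorem continuous_piece (ht : Monotone t) (k p i : ℕ) : Continuous (piece t k p i) := by
  cases p with
  | zero => exact continuous_const
  | succ p =>
    exact continuous_iff_continuousAt.2 fun x => (hasDerivAt_piece ht k p i x).continuousAt

/-- With `q` coincident knots at the right end of the interval, each weight in the recursion that
could matter is `0` or `1`, so the single piece of degree zero survives with its index unchanged.
`piece_of_right` is the mirror image, where the index drops by one per degree. -/
theorem piece_of_left {q : ℕ} (hk : t k < x) (h : ∀ a, k < a → a ≤ k + q → t a = x) (i : ℕ) :
    piece t k q i x = if i = k then 1 else 0 := by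
  induction q generalizing i with
  | zero => rfl
  | succ q ih =>
    simp only [piece, ih fun a h1 h2 => h a h1 (by omega)]
    rcases eq_or_ne i k with rfl | hi
    · have h1 := h (i + q + 1) (by omega) (by omega)
      simp [h1, (sub_pos.2 hk).ne']
    · rcases eq_or_ne (i + 1) k with rfl | hi'
      · have h1 := h (i + q + 2) (by omega) (by omega)
        simp [h1]
      · simp [hi, hi']

theorem piece_of_right {q : ℕ} (hk : x < t (k + 1)) (h : ∀ a, k < a + q → a ≤ k → t a = x)
    (i : ℕ) : piece t k q i x = if i + q = k then 1 else 0 := by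
  induction q generalizing i with
  | zero => rfl
  | succ q ih =>
    simp only [piece, ih fun a h1 h2 => h a (by omega) (by omega)]
    by_cases hi : i + q = k
    · have h1 := h i (by omega) (by omega)
      have h2 : i + 1 + q ≠ k := by omega
      have h3 : i + (q + 1) ≠ k := by omega
      simp [h1, h2, h3]
    · by_cases hi' : i + (q + 1) = k
      · have h1 := h (i + 1) (by omega) (by omega)
        have h2 : i + 1 + q = k := by omega
        have h3 : t (i + q + 2) - x ≠ 0 := by
          rw [show i + q + 2 = k + 1 by omega]; exact (sub_pos.2 hk).ne'
        simp [hi, h1, h2, hi', h3]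
      · have h2 : i + 1 + q ≠ k := by omega
        simp [hi, hi', h2]

/-- Pieces on both sides of a knot agree there if the degree is at least its multiplicity. -/
theorem piece_eq_piece {ν q : ℕ} (hk : t k < x) (hν : x < t (ν + 1)) (hkν : k ≤ ν)
    (h : ∀ a, k < a → a ≤ ν → t a = x) (hq : ν - k ≤ q) (i : ℕ) :
    piece t k q i x = piece t ν q i x := by
  -- In degree `ν - k`, the multiplicity of the knot, both sides are the same Kronecker delta. In
  -- higher degrees the recursion has the same weights on both sides.
  induction q, hq using Nat.le_induction generalizing i with
  | base =>
    rw [piece_of_left hk fun a h1 h2 => h a h1 (by omega),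
      piece_of_right hν fun a h1 h2 => h a (by omega) h2]
    exact if_congr (by omega) rfl rfl
  | succ q _ ih => simp only [piece, ih]

end Pieces

/-! ### Smoothness, end values and bounds of B-splines -/

namespace C1Knots

variable (κ : C1Knots)

theorem t_zero : κ.t 0 = 0 := κ.first 0 (Nat.zero_le _)

theorem t_le_L (i : ℕ) : κ.t i ≤ κ.L :=
  (κ.mono (Nat.le_add_right i (κ.m + 2))).trans_eq (κ.last _ (by omega))

theorem L_pos : 0 < κ.L := κ.first_lt.trans_le (κ.t_le_L _)

variable {κ}

theorem exists_piece_right {x : ℝ} (hx : 0 ≤ x) (hx' : x < κ.L) :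
    ∃ ν, κ.t ν ≤ x ∧ x < κ.t (ν + 1) := by
  classical
  have h : ∃ n, x < κ.t n := ⟨κ.m + 2, by rwa [κ.last _ le_rfl]⟩
  obtain ⟨ν, hν⟩ : ∃ ν, Nat.find h = ν + 1 := Nat.exists_eq_succ_of_ne_zero fun h0 => by
    have := Nat.find_spec h
    rw [h0, κ.t_zero] at this
    exact hx.not_gt this
  exact ⟨ν, not_lt.1 (Nat.find_min h (by omega)), hν ▸ Nat.find_spec h⟩

theorem exists_piece_left {x : ℝ} (hx : 0 < x) (hx' : x ≤ κ.L) :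
    ∃ k, κ.t k < x ∧ x ≤ κ.t (k + 1) := by
  classical
  have h : ∃ n, x ≤ κ.t n := ⟨κ.m + 2, by rwa [κ.last _ le_rfl]⟩
  obtain ⟨ν, hν⟩ : ∃ ν, Nat.find h = ν + 1 := Nat.exists_eq_succ_of_ne_zero fun h0 => by
    have := Nat.find_spec h
    rw [h0, κ.t_zero] at this
    exact this.not_gt hx
  exact ⟨ν, not_le.1 (Nat.find_min h (by omega)), hν ▸ Nat.find_spec h⟩

theorem bspline_eventuallyEq_right {x : ℝ} {ν : ℕ} (hν : κ.t ν ≤ x) (hν' : x < κ.t (ν + 1))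
    (q i : ℕ) : bspline κ.t κ.L q i =ᶠ[𝓝[≥] x] piece κ.t ν q i := by
  filter_upwards [Ico_mem_nhdsGE hν'] with y hy
  exact bspline_eq_piece κ.mono (hν.trans hy.1) hy.2 (hy.2.trans_le (κ.t_le_L _)).ne q i

/-- B-splines are defined through the interval to the right of `x`, so this is continuity from the
left. It holds already in degree `p - 1`, because interior multiplicities are at most `p - 1`; this
is where the `C¹` hypothesis enters. -/
theorem bspline_eq_left_piece {x : ℝ} {k : ℕ} (hk : κ.t k < x) (hk' : x ≤ κ.t (k + 1))
    {q : ℕ} (hq : κ.p ≤ q + 1) (i : ℕ) : bspline κ.t κ.L q i x = piece κ.t k q i x := by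
  rcases (hk'.trans (κ.t_le_L _)).eq_or_lt with rfl | hx
  · exact bspline_last_eq_piece κ.mono κ.t_le_L hk (le_antisymm (κ.t_le_L _) hk') q i
  · have hx0 : 0 < x := (κ.t_zero ▸ κ.mono (Nat.zero_le k) : 0 ≤ κ.t k).trans_lt hk
    obtain ⟨ν, hν, hν'⟩ := exists_piece_right hx0.le hx
    rw [bspline_eq_piece κ.mono hν hν' hx.ne q i]
    have hkν : k ≤ ν := Nat.lt_succ_iff.1 (κ.mono.reflect_lt (hk.trans hν'))
    have hknot : ∀ a, k < a → a ≤ ν → κ.t a = x := fun a h1 h2 =>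
      le_antisymm ((κ.mono h2).trans hν) (hk'.trans (κ.mono h1))
    refine (piece_eq_piece hk hν' hkν hknot ?_ i).symm
    -- Otherwise the `p` knots with indices `k + 1, …, k + p` would all equal the interior point
    -- `x`, against `κ.mult`.
    by_contra! hlt
    have h1 : κ.t (k + 1) = x := hknot _ (by omega) (by omega)
    have h2 : κ.t (k + 1 + κ.p - 1) = x := hknot _ (by have := κ.one_le_p; omega) (by omega)
    have h3 : κ.p < k + 1 := by
      by_contra! h
      exact hx0.ne' (h1 ▸ κ.first _ h)
    have h4 : ν < κ.m + 2 := by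
      by_contra! h
      exact hx.not_ge (κ.last _ h ▸ hν)
    exact (κ.mult (k + 1) h3 (by omega)).ne (h1.trans h2.symm)

theorem bspline_eventuallyEq_left {x : ℝ} {k : ℕ} (hk : κ.t k < x) (hk' : x ≤ κ.t (k + 1))
    {q : ℕ} (hq : κ.p ≤ q + 1) (i : ℕ) : bspline κ.t κ.L q i =ᶠ[𝓝[≤] x] piece κ.t k q i := by
  filter_upwards [Ioc_mem_nhdsLE hk] with y hy
  exact bspline_eq_left_piece hy.1 (hy.2.trans hk') hq i

variable (κ)

theorem continuousOn_bspline {q : ℕ} (hq : κ.p ≤ q + 1) (i : ℕ) :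
    ContinuousOn (bspline κ.t κ.L q i) (Icc 0 κ.L) := by
  intro x hx
  have hr : ContinuousWithinAt (bspline κ.t κ.L q i) (Icc x κ.L) x := by
    rcases hx.2.eq_or_lt with rfl | h
    · simp
    · obtain ⟨ν, hν, hν'⟩ := exists_piece_right hx.1 h
      have := bspline_eventuallyEq_right hν hν' q i
      exact ((continuous_piece κ.mono ν q i).continuousWithinAt.congr_of_eventuallyEq this
        (this.eq_of_nhdsWithin self_mem_Ici)).mono Icc_subset_Ici_self
  have hl : ContinuousWithinAt (bspline κ.t κ.L q i) (Icc 0 x) x := by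
    rcases hx.1.eq_or_lt with rfl | h
    · simp
    · obtain ⟨k, hk, hk'⟩ := exists_piece_left h hx.2
      have := bspline_eventuallyEq_left hk hk' hq i
      exact ((continuous_piece κ.mono k q i).continuousWithinAt.congr_of_eventuallyEq this
        (this.eq_of_nhdsWithin self_mem_Iic)).mono Icc_subset_Iic_self
  exact Icc_union_Icc_eq_Icc hx.1 hx.2 ▸ hl.union hr

/-- The derivatives from both sides are given by one formula in B-splines of degree `q`, and these
take the value of the adjacent piece on either side, so the two half-derivatives glue. -/
theorem hasDerivWithinAt_bspline {q : ℕ} (hq : κ.p ≤ q + 1) (i : ℕ) {x : ℝ}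
    (hx : x ∈ Icc 0 κ.L) :
    HasDerivWithinAt (bspline κ.t κ.L (q + 1) i)
      ((q + 1 : ℝ) / (κ.t (i + q + 1) - κ.t i) * bspline κ.t κ.L q i x -
        (q + 1 : ℝ) / (κ.t (i + q + 2) - κ.t (i + 1)) * bspline κ.t κ.L q (i + 1) x)
      (Icc 0 κ.L) x := by
  have hr : HasDerivWithinAt (bspline κ.t κ.L (q + 1) i)
      ((q + 1 : ℝ) / (κ.t (i + q + 1) - κ.t i) * bspline κ.t κ.L q i x -
        (q + 1 : ℝ) / (κ.t (i + q + 2) - κ.t (i + 1)) * bspline κ.t κ.L q (i + 1) x)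
      (Icc x κ.L) x := by
    rcases hx.2.eq_or_lt with rfl | h
    -- At an end point of `[0, L]` one of the two intervals is a single point, where any derivative
    -- is allowed.
    · exact hasDerivWithinAt_iff_hasFDerivWithinAt.2 (.of_subsingleton (by simp))
    · obtain ⟨ν, hν, hν'⟩ := exists_piece_right hx.1 h
      have h0 := fun q i => bspline_eventuallyEq_right hν hν' q i
      have h1 := fun q i => (h0 q i).eq_of_nhdsWithin self_mem_Ici
      rw [h1, h1]
      exact ((hasDerivAt_piece κ.mono ν q i x).hasDerivWithinAt.congr_of_eventuallyEq (h0 _ _)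
        (h1 _ _)).mono Icc_subset_Ici_self
  have hl : HasDerivWithinAt (bspline κ.t κ.L (q + 1) i)
      ((q + 1 : ℝ) / (κ.t (i + q + 1) - κ.t i) * bspline κ.t κ.L q i x -
        (q + 1 : ℝ) / (κ.t (i + q + 2) - κ.t (i + 1)) * bspline κ.t κ.L q (i + 1) x)
      (Icc 0 x) x := by
    rcases hx.1.eq_or_lt with rfl | h
    · exact hasDerivWithinAt_iff_hasFDerivWithinAt.2 (.of_subsingleton (by simp))
    · obtain ⟨k, hk, hk'⟩ := exists_piece_left h hx.2
      rw [bspline_eq_left_piece hk hk' hq, bspline_eq_left_piece hk hk' hq]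
      exact ((hasDerivAt_piece κ.mono k q i x).hasDerivWithinAt.congr_of_eventuallyEq
        (bspline_eventuallyEq_left hk hk' (by omega) i)
        (bspline_eq_left_piece hk hk' (by omega) i)).mono Icc_subset_Iic_self
  exact Icc_union_Icc_eq_Icc hx.1 hx.2 ▸ hl.union hr

theorem bspline_at_zero (q i : ℕ) :
    bspline κ.t κ.L q i 0 = if i + q = κ.p then 1 else 0 := by
  rw [bspline_eq_piece κ.mono (κ.first κ.p le_rfl).le κ.first_lt κ.L_pos.ne]
  exact piece_of_right κ.first_lt (fun a _ h => κ.first a h) i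

theorem bspline_at_L (q i : ℕ) :
    bspline κ.t κ.L q i κ.L = if i = κ.m + 1 then 1 else 0 := by
  rw [bspline_last_eq_piece κ.mono κ.t_le_L κ.lt_last (κ.last _ le_rfl)]
  exact piece_of_left κ.lt_last (fun a h _ => κ.last a h) i

/-- Needed to pass from equality on `Ω` to equality of functions on the whole space in
`eq_of_eqOn_Ω`. -/
theorem bspline_of_notMem {x : ℝ} (hx : x ∉ Icc 0 κ.L) (q i : ℕ) :
    bspline κ.t κ.L q i x = 0 := by
  induction q generalizing i with
  | zero =>
    refine if_neg ?_
    rintro (h | h)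
    · exact hx ⟨(κ.t_zero ▸ κ.mono (Nat.zero_le i) : 0 ≤ κ.t i).trans h.1,
        h.2.le.trans (κ.t_le_L _)⟩
    · exact hx ⟨h.2.2 ▸ κ.L_pos.le, h.2.2.le⟩
  | succ q ih => simp [bspline, ih]

theorem exists_abs_bspline_le (q i : ℕ) :
    ∃ M, ∀ x ∈ Icc 0 κ.L, |bspline κ.t κ.L q i x| ≤ M := by
  induction q generalizing i with
  | zero =>
    refine ⟨1, fun x _ => ?_⟩
    simp only [bspline]
    split_ifs <;> simp
  | succ q ih =>
    obtain ⟨M, hM⟩ := ih i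
    obtain ⟨M', hM'⟩ := ih (i + 1)
    refine ⟨κ.L / |κ.t (i + q + 1) - κ.t i| * M +
      κ.L / |κ.t (i + q + 2) - κ.t (i + 1)| * M', fun x hx => ?_⟩
    have h0 : ∀ j, 0 ≤ κ.t j := fun j => κ.t_zero ▸ κ.mono (Nat.zero_le j)
    have h1 : |x - κ.t i| ≤ κ.L := abs_sub_le_iff.2
      ⟨by linarith [hx.2, h0 i], by linarith [hx.1, κ.t_le_L i]⟩
    have h2 : |κ.t (i + q + 2) - x| ≤ κ.L := abs_sub_le_iff.2
      ⟨by linarith [hx.1, κ.t_le_L (i + q + 2)], by linarith [hx.2, h0 (i + q + 2)]⟩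
    refine (abs_add_le _ _).trans (add_le_add ?_ ?_) <;> rw [abs_mul, abs_div]
    · exact mul_le_mul (div_le_div_of_nonneg_right h1 (abs_nonneg _)) (hM x hx) (abs_nonneg _)
        (div_nonneg κ.L_pos.le (abs_nonneg _))
    · exact mul_le_mul (div_le_div_of_nonneg_right h2 (abs_nonneg _)) (hM' x hx) (abs_nonneg _)
        (div_nonneg κ.L_pos.le (abs_nonneg _))

/-- A B-spline whose support does not reach `0` with full multiplicity vanishes there to first
order. -/
theorem exists_abs_bspline_le_mul {q i : ℕ} (hi : κ.p < i + q) :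
    ∃ M, ∀ x ∈ Icc 0 κ.L, |bspline κ.t κ.L q i x| ≤ M * x := by
  induction q generalizing i with
  | zero =>
    refine ⟨1 / κ.t (κ.p + 1), fun x hx => ?_⟩
    simp only [bspline]
    have hti : κ.t (κ.p + 1) ≤ κ.t i := κ.mono hi
    have h0 : 0 ≤ 1 / κ.t (κ.p + 1) * x := mul_nonneg (one_div_nonneg.2 κ.first_lt.le) hx.1
    split_ifs with h
    · rw [abs_one, one_div, ← div_eq_inv_mul, one_le_div κ.first_lt]
      rcases h with h | h
      · exact hti.trans h.1
      · rw [h.2.2]; exact κ.t_le_L _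
    · simpa using h0
  | succ q ih =>
    obtain ⟨M', hM'⟩ := ih (i := i + 1) (by omega)
    obtain ⟨M, hM⟩ : ∃ M, ∀ x ∈ Icc 0 κ.L, |(x - κ.t i) * bspline κ.t κ.L q i x| ≤ M * x := by
      -- In the borderline case `i + q = p` the lower-degree B-spline need not vanish at `0`, but
      -- then `t i = 0` and the weight `x - t i` supplies the factor `x`.
      rcases Nat.lt_or_ge κ.p (i + q) with h | h
      · obtain ⟨M, hM⟩ := ih h
        refine ⟨κ.L * M, fun x hx => ?_⟩
        have h0 : 0 ≤ κ.t i := κ.t_zero ▸ κ.mono (Nat.zero_le i)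
        have h1 : |x - κ.t i| ≤ κ.L := abs_sub_le_iff.2
          ⟨by linarith [hx.2], by linarith [hx.1, κ.t_le_L i]⟩
        rw [abs_mul, mul_assoc]
        exact mul_le_mul h1 (hM x hx) (abs_nonneg _) κ.L_pos.le
      · obtain ⟨M, hM⟩ := κ.exists_abs_bspline_le q i
        refine ⟨M, fun x hx => ?_⟩
        rw [κ.first i (by omega), sub_zero, abs_mul, abs_of_nonneg hx.1, mul_comm]
        exact mul_le_mul_of_nonneg_right (hM x hx) hx.1
    refine ⟨M / |κ.t (i + q + 1) - κ.t i| +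
      κ.L / |κ.t (i + q + 2) - κ.t (i + 1)| * M', fun x hx => ?_⟩
    have h0 : 0 ≤ κ.t (i + q + 2) := κ.t_zero ▸ κ.mono (Nat.zero_le _)
    have h2 : |κ.t (i + q + 2) - x| ≤ κ.L := abs_sub_le_iff.2
      ⟨by linarith [hx.1, κ.t_le_L (i + q + 2)], by linarith [hx.2]⟩
    rw [add_mul]
    refine (abs_add_le _ _).trans (add_le_add ?_ ?_)
    · rw [div_mul_eq_mul_div, abs_div, div_mul_eq_mul_div]
      exact div_le_div_of_nonneg_right (hM x hx) (abs_nonneg _)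
    · rw [abs_mul, abs_div, mul_assoc]
      exact mul_le_mul (div_le_div_of_nonneg_right h2 (abs_nonneg _)) (hM' x hx) (abs_nonneg _)
        (div_nonneg κ.L_pos.le (abs_nonneg _))

end C1Knots

/-! ### Difference matrices, and derivatives of open and periodic splines -/

theorem sum_diff_mul {q : ℕ} (l : Fin q) (f : Fin (q + 1) → ℝ) :
    ∑ j, diff q l j * f j = f l.succ - f l.castSucc := by
  simp [diff, sub_mul, Finset.sum_sub_distrib]

theorem sum_diffPer_mul {q : ℕ} (l : Fin q) (f : Fin q → ℝ) :
    ∑ j, diffPer q l j * f j = f (finRotate q l) - f l := by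
  simp [diffPer, sub_mul, Finset.sum_sub_distrib]

theorem val_finRotate {q : ℕ} (i : Fin q) :
    ((finRotate q i : Fin q) : ℕ) = if (i : ℕ) + 1 = q then 0 else (i : ℕ) + 1 := by
  cases q with
  | zero => exact i.elim0
  | succ q =>
    rw [coe_finRotate]
    simp [Fin.ext_iff]

namespace C1Knots

variable (κ : C1Knots)

theorem continuousOn_D (j : Fin (κ.m + 1)) : ContinuousOn (κ.D j) (Icc 0 κ.L) :=
  (κ.continuousOn_bspline (by omega) _).const_mul _

/-- The derivatives of B-splines. -/
theorem hasDerivWithinAt_B (j : Fin (κ.m + 2)) {x : ℝ} (hx : x ∈ Icc 0 κ.L) :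
    HasDerivWithinAt (κ.B j) (∑ l, diff (κ.m + 1) l j * κ.D l x) (Icc 0 κ.L) x := by
  obtain ⟨q, hq⟩ : ∃ q, κ.p = q + 1 := Nat.exists_eq_succ_of_ne_zero (by have := κ.one_le_p; omega)
  have h := κ.hasDerivWithinAt_bspline hq.le j hx
  unfold B
  rw [hq]
  refine h.congr_deriv ?_
  have h1 : ∑ l : Fin (κ.m + 1), (if j = l.succ then (1 : ℝ) else 0) * κ.D l x =
      (q + 1 : ℝ) / (κ.t (j + q + 1) - κ.t j) * bspline κ.t κ.L q j x := by
    -- The first B-spline has no left neighbour among the `D`, the last one no right neighbour. The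
    -- corresponding term of the derivative formula has knot difference zero and vanishes by `x / 0
    -- = 0`.
    cases j using Fin.cases with
    | zero =>
      have : κ.t (q + 1) = κ.t 0 := by rw [κ.first _ (by omega), κ.t_zero]
      simp [(Fin.succ_ne_zero _).symm, this]
    | succ l =>
      simp [D, hq, add_comm, add_left_comm]
  have h2 : ∑ l : Fin (κ.m + 1), (if j = l.castSucc then (1 : ℝ) else 0) * κ.D l x =
      (q + 1 : ℝ) / (κ.t (j + q + 2) - κ.t (j + 1)) * bspline κ.t κ.L q (j + 1) x := by
    cases j using Fin.lastCases with
    | last =>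
      have h3 : κ.t (κ.m + 1 + q + 2) = κ.L := κ.last _ (by omega)
      have h4 : κ.t (κ.m + 1 + 1) = κ.L := κ.last _ (by omega)
      have h5 : ∀ l : Fin (κ.m + 1), Fin.last (κ.m + 1) ≠ l.castSucc := fun l h =>
        (Fin.castSucc_lt_last l).ne h.symm
      simp [h3, h4, h5]
    | cast l =>
      simp [D, hq, add_assoc]
  simp only [diff, of_apply, sub_mul, Finset.sum_sub_distrib]
  rw [h1, h2]

theorem B_at_zero (j : Fin (κ.m + 2)) : κ.B j 0 = if j = 0 then 1 else 0 := by
  rw [B, bspline_at_zero]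
  exact if_congr (by rw [Fin.ext_iff, Fin.val_zero]; omega) rfl rfl

theorem B_at_L (j : Fin (κ.m + 2)) : κ.B j κ.L = if j = Fin.last _ then 1 else 0 := by
  rw [B, bspline_at_L]
  exact if_congr (by rw [Fin.ext_iff, Fin.val_last]) rfl rfl

theorem D_at_zero (j : Fin (κ.m + 1)) :
    κ.D j 0 = if j = 0 then κ.p / κ.t (κ.p + 1) else 0 := by
  have := κ.one_le_p
  rw [D, bspline_at_zero]
  rcases eq_or_ne j 0 with rfl | h
  · have h1 : κ.t (0 + 1) = 0 := κ.first _ (by omega)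
    have h2 : 0 + 1 + (κ.p - 1) = κ.p := by omega
    simp [h1, h2]
  · have h2 : (j : ℕ) + 1 + (κ.p - 1) ≠ κ.p := by
      have : (j : ℕ) ≠ 0 := fun h0 => h (Fin.ext h0)
      omega
    simp [h, h2]

theorem D_at_L (j : Fin (κ.m + 1)) :
    κ.D j κ.L = if j = Fin.last _ then κ.p / (κ.L - κ.t (κ.m + 1)) else 0 := by
  have := κ.one_le_p
  rw [D, bspline_at_L]
  rcases eq_or_ne j (Fin.last _) with rfl | h
  · simp [κ.last (κ.m + κ.p + 1) (by omega)]
  · have : (j : ℕ) ≠ κ.m := fun h0 => h (Fin.ext h0)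
    simp [h, this]

theorem D_of_notMem (j : Fin (κ.m + 1)) {x : ℝ} (hx : x ∉ Icc 0 κ.L) : κ.D j x = 0 := by
  rw [D, κ.bspline_of_notMem hx, mul_zero]

theorem exists_abs_D_le_mul {j : Fin (κ.m + 1)} (hj : j ≠ 0) :
    ∃ M, ∀ x ∈ Icc 0 κ.L, |κ.D j x| ≤ M * x := by
  obtain ⟨M, hM⟩ := κ.exists_abs_bspline_le_mul (q := κ.p - 1) (i := j + 1)
    (by have := κ.one_le_p; have : (j : ℕ) ≠ 0 := fun h => hj (Fin.ext h); omega)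
  refine ⟨|(κ.p : ℝ) / (κ.t (j + κ.p + 1) - κ.t (j + 1))| * M, fun x hx => ?_⟩
  rw [D, abs_mul, mul_assoc]
  exact mul_le_mul_of_nonneg_left (hM x hx) (abs_nonneg _)

/-- The differences of constant coefficients vanish, so the sum has derivative zero, and at `0` only
the first B-spline contributes. -/
theorem sum_B {x : ℝ} (hx : x ∈ Icc 0 κ.L) : ∑ j, κ.B j x = 1 := by
  have hd : ∀ y ∈ Icc 0 κ.L, HasDerivWithinAt (fun y => ∑ j, κ.B j y) 0 (Icc 0 κ.L) y := by
    intro y hy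
    refine (HasDerivWithinAt.fun_sum fun j _ => κ.hasDerivWithinAt_B j hy).congr_deriv ?_
    rw [Finset.sum_comm]
    refine Finset.sum_eq_zero fun l _ => ?_
    rw [← Finset.sum_mul]
    have := sum_diff_mul l fun _ => 1
    simp only [mul_one, sub_self] at this
    rw [this, zero_mul]
  have := constant_of_has_deriv_right_zero (fun y hy => (hd y hy).continuousWithinAt)
    (fun y hy => (hd y ⟨hy.1, hy.2.le⟩).mono_of_mem_nhdsWithin (Icc_mem_nhdsGE_of_mem hy)) x hx
  rw [this]
  simp [B_at_zero]

theorem c_denom_pos : 0 < κ.t (κ.m + 2 + κ.p) - κ.t (κ.m + 1) + κ.t (κ.p + 1) - κ.t 0 := by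
  rw [κ.last (κ.m + 2 + κ.p) (by omega), κ.t_zero]
  linarith [κ.lt_last, κ.first_lt]

theorem c₁_add_c₂ : κ.c₁ + κ.c₂ = 1 := by
  rw [c₁, c₂, ← add_div, div_eq_one_iff_eq κ.c_denom_pos.ne']
  ring

theorem sum_H₀ (hm : 0 < κ.m) (j : Fin (κ.m + 2)) : ∑ i, κ.H₀ i j = 1 := by
  obtain ⟨j, hj⟩ := j
  have h1 : ∑ i : Fin κ.m, (if (i : ℕ) = 0 then κ.c₁ else 0) = κ.c₁ := by
    rw [Finset.sum_eq_single (⟨0, hm⟩ : Fin κ.m)] <;> simp +contextual [Fin.ext_iff]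
  have h2 : ∑ i : Fin κ.m, (if (i : ℕ) + 1 = κ.m then κ.c₂ else 0) = κ.c₂ := by
    rw [Finset.sum_eq_single (⟨κ.m - 1, by omega⟩ : Fin κ.m)]
    · rw [if_pos (by simp; omega)]
    · intro i _ hi
      exact if_neg fun h => hi (Fin.ext (by simp; omega))
    · simp
  simp only [H₀, of_apply, Finset.sum_add_distrib]
  by_cases h : j = 0 ∨ j = κ.m + 1
  · have : ∀ i : Fin κ.m, ¬ j = i + 1 := fun i => by omega
    simp only [this, if_false, Finset.sum_const_zero, zero_add, h, if_true,
      Finset.sum_add_distrib, h1, h2, κ.c₁_add_c₂]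
  · simp only [h, if_false, Finset.sum_const_zero, add_zero]
    rw [Finset.sum_eq_single (⟨j - 1, by omega⟩ : Fin κ.m)]
    · rw [if_pos (by simp; omega)]
    · intro i _ hi
      exact if_neg fun h => hi (Fin.ext (by simp; omega))
    · simp

theorem sum_Bper (hm : 0 < κ.m) {x : ℝ} (hx : x ∈ Icc 0 κ.L) : ∑ i, κ.Bper i x = 1 := by
  unfold Bper
  rw [Finset.sum_comm]
  simp only [← Finset.sum_mul, κ.sum_H₀ hm, one_mul, κ.sum_B hx]

/-- The periodic basis functions have matching values at the end points. -/
theorem Bper_L (i : Fin κ.m) : κ.Bper i κ.L = κ.Bper i 0 := by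
  have h1 : κ.Bper i κ.L = κ.H₀ i (Fin.last _) := by simp [Bper, B_at_L]
  have h2 : κ.Bper i 0 = κ.H₀ i 0 := by simp [Bper, B_at_zero]
  have := i.isLt
  have h3 : κ.m ≠ (i : ℕ) := by omega
  rw [h1, h2]
  simp [H₀, h3]

/-- This is what the weights are made for: `c₁` and `c₂` are proportional to the last and the first
knot span, which are the denominators of the end values of the `D`, so the values at both ends
balance. -/
theorem Dper_L (i : Fin κ.m) : κ.Dper i κ.L = κ.Dper i 0 := by
  have hi := i.isLt
  have h1 : κ.Dper i κ.L = κ.H₁ i (Fin.last _) * (κ.p / (κ.L - κ.t (κ.m + 1))) := by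
    simp [Dper, D_at_L]
  have h2 : κ.Dper i 0 = κ.H₁ i 0 * (κ.p / κ.t (κ.p + 1)) := by simp [Dper, D_at_zero]
  have h3 : κ.H₁ i (Fin.last _) = if (i : ℕ) + 1 = κ.m then κ.c₁ else 0 := by
    simp only [H₁, of_apply, Fin.val_last]
    split_ifs <;> first | omega | simp
  have h4 : κ.H₁ i 0 = if (i : ℕ) + 1 = κ.m then κ.c₂ else 0 := by
    have h5 : ¬ 0 = κ.m := by omega
    simp [H₁, h5]
  rw [h1, h2, h3, h4]
  split_ifs
  · have e1 := κ.last (κ.m + 2 + κ.p) (by omega)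
    have e2 := (sub_pos.2 κ.lt_last).ne'
    have e3 := κ.first_lt.ne'
    have e4 := κ.c_denom_pos.ne'
    simp only [e1, κ.t_zero, sub_zero] at e4
    simp only [c₁, c₂, e1, κ.t_zero, sub_zero]
    field_simp
  · simp

/-- Folding the open basis into the periodic one turns plain differences into cyclic ones. Of the
weights only `c₁ + c₂ = 1` is used. -/
theorem H₀_diff (i : Fin κ.m) (l : Fin (κ.m + 1)) :
    ∑ j, κ.H₀ i j * diff (κ.m + 1) l j = ∑ q, diffPer κ.m q i * κ.H₁ q l := by
  have h1 := sum_diff_mul l fun j => κ.H₀ i j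
  have h2 : ∑ q, diffPer κ.m q i * κ.H₁ q l =
      κ.H₁ ((finRotate κ.m).symm i) l - κ.H₁ i l := by
    simp only [diffPer, of_apply, sub_mul, Finset.sum_sub_distrib, ite_mul, one_mul, zero_mul,
      ← Equiv.symm_apply_eq]
    simp
  simp only [mul_comm (κ.H₀ i _)]
  rw [h1, h2]
  obtain ⟨a, rfl⟩ := (finRotate κ.m).surjective i
  rw [Equiv.symm_apply_apply]
  have ha := a.isLt
  have hl := l.isLt
  have hc := κ.c₁_add_c₂
  simp only [H₀, H₁, of_apply, val_finRotate, Fin.val_succ, Fin.val_castSucc]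
  generalize (a : ℕ) = a at *
  generalize (l : ℕ) = l at *
  have hc' : κ.c₂ = 1 - κ.c₁ := by linarith
  rw [hc']
  -- Only extreme rows and columns are special, but for small `m` they coincide, so all relative
  -- positions are separated.
  by_cases h : a + 1 = κ.m <;> by_cases h' : l = 0 <;> by_cases h'' : l = κ.m <;>
    by_cases h3 : l = a + 1 <;> by_cases h4 : κ.m = 1 <;> by_cases h5 : a + 2 = κ.m <;>
    by_cases h6 : l = a + 2 <;>
    first
    | omega
    | (simp (disch := omega) only [if_pos, if_neg, if_true]; ring)

/-- The derivatives of periodic splines. -/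
theorem hasDerivWithinAt_Bper (i : Fin κ.m) {x : ℝ} (hx : x ∈ Icc 0 κ.L) :
    HasDerivWithinAt (κ.Bper i) (∑ q, diffPer κ.m q i * κ.Dper q x) (Icc 0 κ.L) x := by
  refine (HasDerivWithinAt.fun_sum fun j _ =>
    (κ.hasDerivWithinAt_B j hx).const_mul (κ.H₀ i j)).congr_deriv ?_
  simp only [Dper, Finset.mul_sum, ← mul_assoc]
  rw [Finset.sum_comm, Finset.sum_comm (s := (Finset.univ : Finset (Fin κ.m)))]
  simp only [← Finset.sum_mul, H₀_diff]

theorem continuousOn_Dper (i : Fin κ.m) : ContinuousOn (κ.Dper i) (Icc 0 κ.L) :=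
  continuousOn_finsetSum _ fun j _ => (κ.continuousOn_D j).const_mul _

theorem Dper_of_notMem (i : Fin κ.m) {x : ℝ} (hx : x ∉ Icc 0 κ.L) : κ.Dper i x = 0 := by
  simp [Dper, κ.D_of_notMem _ hx]

end C1Knots

/-- Transposition: lets a matrix act either on coefficients or on basis functions. -/
theorem sum_mulVec_mul {α β : Type*} [Fintype α] [Fintype β] (M : Matrix β α ℝ) (h : α → ℝ)
    (g : β → ℝ) : ∑ b, (M *ᵥ h) b * g b = ∑ a, h a * ∑ b, M b a * g b := by
  simp only [mulVec, dotProduct, Finset.sum_mul, Finset.mul_sum]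
  rw [Finset.sum_comm]
  exact Finset.sum_congr rfl fun a _ => Finset.sum_congr rfl fun b _ => by ring

namespace Setting

variable (P : Setting)

/-! ### Divergences of tensor spline fields -/

theorem hasDiv_tensorField (h₁ : P.Idx' → ℝ) (h₂ : P.Idx → ℝ) (h₃ : P.Idx' → ℝ) :
    P.HasDiv (P.tensorField h₁ h₂ h₃)
      (P.tensorFun (P.D100 *ᵥ h₁ + P.D010 *ᵥ h₂ + P.D001 *ᵥ h₃)) := by
  refine ⟨![P.tensorFun (P.D100 *ᵥ h₁), P.tensorFun (P.D010 *ᵥ h₂), P.tensorFun (P.D001 *ᵥ h₃)],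
    fun x hx => ⟨fun a => ?_, ?_⟩⟩
  · fin_cases a
    · change HasDerivWithinAt (fun y => ∑ a, h₁ a * P.B011 a (Function.update x 0 y))
        (∑ a, (P.D100 *ᵥ h₁) a * P.B111 a x) (Icc 0 P.kr.L) (x 0)
      -- With the difference matrix moved onto the basis functions, the claim can be checked for
      -- each basis function, where only the factor in the current direction is differentiated.
      rw [sum_mulVec_mul]
      refine HasDerivWithinAt.fun_sum fun a _ => HasDerivWithinAt.const_mul _ ?_
      refine HasDerivWithinAt.congr_deriv (f' := (∑ q, diffPer P.nr q a.2.2 *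
        P.kr.Dper q (x 0)) * P.ks.D a.2.1 (x 1) * P.kt.Dper a.1 (x 2)) ?_ ?_
      · simp only [B011, Function.update_self, Function.update_of_ne, ne_eq, Fin.reduceEq,
          not_false_eq_true]
        exact ((P.kr.hasDerivWithinAt_Bper _ (hx 0)).mul_const _).mul_const _
      · simp [D100, B111, Fintype.sum_prod_type, one_apply, Finset.sum_mul, ← mul_assoc,
          Finset.sum_ite_irrel]
    · change HasDerivWithinAt (fun y => ∑ a, h₂ a * P.B101 a (Function.update x 1 y))
        (∑ a, (P.D010 *ᵥ h₂) a * P.B111 a x) (Icc 0 P.ks.L) (x 1)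
      rw [sum_mulVec_mul]
      refine HasDerivWithinAt.fun_sum fun a _ => HasDerivWithinAt.const_mul _ ?_
      refine HasDerivWithinAt.congr_deriv (f' := P.kr.Dper a.2.2 (x 0) *
        (∑ q, diff (P.ms + 1) q a.2.1 * P.ks.D q (x 1)) * P.kt.Dper a.1 (x 2)) ?_ ?_
      · simp only [B101, Function.update_self, Function.update_of_ne, ne_eq, Fin.reduceEq,
          not_false_eq_true]
        exact ((P.ks.hasDerivWithinAt_B _ (hx 1)).const_mul _).mul_const _
      · simp [D010, B111, Fintype.sum_prod_type, one_apply, Finset.sum_mul, Finset.mul_sum,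
          mul_assoc, mul_left_comm, Finset.sum_ite_irrel]
    · change HasDerivWithinAt (fun y => ∑ a, h₃ a * P.B110 a (Function.update x 2 y))
        (∑ a, (P.D001 *ᵥ h₃) a * P.B111 a x) (Icc 0 P.kt.L) (x 2)
      rw [sum_mulVec_mul]
      refine HasDerivWithinAt.fun_sum fun a _ => HasDerivWithinAt.const_mul _ ?_
      refine HasDerivWithinAt.congr_deriv (f' := P.kr.Dper a.2.2 (x 0) * P.ks.D a.2.1 (x 1) *
        (∑ q, diffPer P.nt q a.1 * P.kt.Dper q (x 2))) ?_ ?_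
      · simp only [B110, Function.update_self, Function.update_of_ne, ne_eq, Fin.reduceEq,
          not_false_eq_true]
        exact (P.kt.hasDerivWithinAt_Bper _ (hx 2)).const_mul _
      · simp [D001, B111, Fintype.sum_prod_type, one_apply, Finset.mul_sum,
          mul_assoc, mul_left_comm]
  · simp only [tensorFun, Fin.sum_univ_three, Pi.add_apply, add_mul, Finset.sum_add_distrib]
    rfl

/-! ### The square of degrees of freedom -/

theorem D100_mulVec (v : P.Idx' → ℝ) (k : Fin P.nt) (j : Fin (P.ms + 1)) (i : Fin P.nr) :
    (P.D100 *ᵥ v) (k, j, i) = v (k, j, finRotate P.nr i) - v (k, j, i) := by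
  simp [D100, mulVec, dotProduct, Fintype.sum_prod_type, one_apply, Finset.sum_ite_irrel,
    sum_diffPer_mul]

theorem D010_mulVec (v : P.Idx → ℝ) (k : Fin P.nt) (j : Fin (P.ms + 1)) (i : Fin P.nr) :
    (P.D010 *ᵥ v) (k, j, i) = v (k, j.succ, i) - v (k, j.castSucc, i) := by
  simp [D010, mulVec, dotProduct, Fintype.sum_prod_type, one_apply, Finset.sum_ite_irrel,
    sum_diff_mul _ fun j => v (k, j, i)]

theorem D001_mulVec (v : P.Idx' → ℝ) (k : Fin P.nt) (j : Fin (P.ms + 1)) (i : Fin P.nr) :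
    (P.D001 *ᵥ v) (k, j, i) = v (finRotate P.nt k, j, i) - v (k, j, i) := by
  simp [D001, mulVec, dotProduct, Fintype.sum_prod_type, one_apply,
    sum_diffPer_mul _ fun k => v (k, j, i)]

variable (h : P.I₂ → ℝ) (k : Fin P.nt) (j : Fin P.ms) (i : Fin P.nr)

theorem E011_mulVec (x : Fin (P.ms + 1) × Fin P.nr) :
    (P.E011ᵀ *ᵥ h) (k, x) = ∑ y, P.E01 y x * h (k, .inr y) := by
  simp [E011, mulVec, dotProduct, Fintype.sum_prod_type, one_apply, Finset.sum_ite_irrel]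

theorem E101_mulVec (x : Fin (P.ms + 2) × Fin P.nr) :
    (P.E101ᵀ *ᵥ h) (k, x) = -∑ y, P.E10 y x * h (k, .inr y) := by
  simp [E101, mulVec, dotProduct, Fintype.sum_prod_type, one_apply, Finset.sum_ite_irrel]

theorem E110_mulVec (x : Fin (P.ms + 1) × Fin P.nr) :
    (P.E110ᵀ *ᵥ h) (k, x) = ∑ y, P.E2 y x * h (k, .inl y) := by
  simp [E110, mulVec, dotProduct, Fintype.sum_prod_type, one_apply, Finset.sum_ite_irrel]

theorem E111_mulVec (m : P.I₃ → ℝ) (x : Fin (P.ms + 1) × Fin P.nr) :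
    (P.E111ᵀ *ᵥ m) (k, x) = ∑ y, P.E2 y x * m (k, y) := by
  simp [E111, mulVec, dotProduct, Fintype.sum_prod_type, one_apply, Finset.sum_ite_irrel]

theorem sum_E2_zero (g : P.J₂ → ℝ) : ∑ y, P.E2 y (0, i) * g y = 0 := by
  simp [E2, (Fin.succ_ne_zero _).symm]

theorem sum_E2_succ (g : P.J₂ → ℝ) : ∑ y, P.E2 y (j.succ, i) * g y = g (j, i) := by
  simp [E2, Fintype.sum_prod_type, ite_and]

theorem E011_mulVec_zero : (P.E011ᵀ *ᵥ h) (k, 0, i) =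
    ∑ l : Fin 2, (P.Ebar₂ l.succ i - P.Ebar₁ l.succ i) * h (k, .inr (.inl l)) := by
  simp [E011_mulVec, E01]

theorem E011_mulVec_succ : (P.E011ᵀ *ᵥ h) (k, j.succ, i) = h (k, .inr (.inr (j, 0, i))) := by
  simp [E011_mulVec, E01, Fintype.sum_prod_type, ite_and, Fin.val_inj]

theorem E101_mulVec_zero : (P.E101ᵀ *ᵥ h) (k, 0, i) = 0 := by
  simp [E101_mulVec, E10]

theorem E101_mulVec_one : (P.E101ᵀ *ᵥ h) (k, 1, i) =
    -∑ l : Fin 2, P.ΔEbar₂ l.succ i * h (k, .inr (.inl l)) := by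
  simp [E101_mulVec, E10]

theorem E101_mulVec_succ_succ :
    (P.E101ᵀ *ᵥ h) (k, j.succ.succ, i) = -h (k, .inr (.inr (j, 1, i))) := by
  simp [E101_mulVec, E10, Fintype.sum_prod_type, ite_and, Fin.val_inj]

/-- In the row `j = 0` the cyclic difference in `r` of the radial coefficients is `ΔEbar₂` applied
to the special ones, as `Ebar₁` is constant; the difference in `s` is its negative. In the other
rows the entries agree one by one, the special faces replacing the inner poloidal face of the first
ring. -/
theorem coefficients_commute :
    P.D100 *ᵥ (P.E011ᵀ *ᵥ h) + P.D010 *ᵥ (P.E101ᵀ *ᵥ h) + P.D001 *ᵥ (P.E110ᵀ *ᵥ h) =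
      P.E111ᵀ *ᵥ P.polarDiv h := by
  funext ⟨k, j, i⟩
  simp only [Pi.add_apply, D100_mulVec, D010_mulVec, D001_mulVec, E110_mulVec, E111_mulVec]
  cases j using Fin.cases with
  | zero =>
    have h1 : (0 : Fin (P.ms + 1)).succ = 1 := rfl
    have h0 : (0 : Fin (P.ms + 1)).castSucc = 0 := rfl
    simp only [E011_mulVec_zero, h1, h0, E101_mulVec_zero, E101_mulVec_one, sum_E2_zero,
      ← Finset.sum_sub_distrib, ΔEbar₂, Ebar₁]
    rw [sub_zero, sub_zero, add_zero, ← Finset.sum_neg_distrib, ← Finset.sum_add_distrib]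
    exact Finset.sum_eq_zero fun l _ => by ring
  | succ j =>
    simp only [E011_mulVec_succ, E101_mulVec_succ_succ, sum_E2_succ, polarDiv]
    by_cases hj : (j : ℕ) = 0
    · have h1 : j.succ.castSucc = 1 := Fin.ext (by simp [hj])
      rw [h1, E101_mulVec_one, if_pos hj]
      ring
    · have h1 : j.succ.castSucc =
          (⟨(j : ℕ) - 1, lt_of_le_of_lt (Nat.sub_le _ _) j.isLt⟩ : Fin P.ms).succ.succ :=
        Fin.ext (by simp; omega)
      rw [h1, E101_mulVec_succ_succ, if_neg hj]
      ring

/-! ### The divergence on the reduced spaces -/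

/-- Restriction and extraction use transposed matrices, so a restricted field is the very element of
`V₂` with the same degrees of freedom. -/
theorem restrictedField_eq : P.restrictedField h = ∑ l, h l • P.N₂ l := by
  funext a x
  fin_cases a <;>
  simp [restrictedField, tensorField, sum_mulVec_mul, N₂, Finset.sum_apply]

theorem restrictedFun_eq (m : P.I₃ → ℝ) : P.restrictedFun m = ∑ l, m l • P.N₃ l := by
  funext x
  simp [restrictedFun, tensorFun, sum_mulVec_mul, N₃, Finset.sum_apply]

theorem hasDiv_N₂ : P.HasDiv (∑ l, h l • P.N₂ l) (∑ l, P.polarDiv h l • P.N₃ l) := by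
  rw [← restrictedField_eq, ← restrictedFun_eq, restrictedFun, ← coefficients_commute]
  exact P.hasDiv_tensorField _ _ _

/-! ### Extraction operators -/

theorem len_pos (a : Fin 3) : 0 < P.len a := by
  fin_cases a
  exacts [P.kr.L_pos, P.ks.L_pos, P.kt.L_pos]

variable {P}

theorem HasDiv.add {f f' : Fin 3 → Pt → ℝ} {g g' : Pt → ℝ} (hf : P.HasDiv f g)
    (hf' : P.HasDiv f' g') : P.HasDiv (f + f') (g + g') := by
  obtain ⟨d, hd⟩ := hf
  obtain ⟨d', hd'⟩ := hf'
  refine ⟨d + d', fun x hx => ⟨fun a => ((hd x hx).1 a).add ((hd' x hx).1 a), ?_⟩⟩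
  simp [(hd x hx).2, (hd' x hx).2, Finset.sum_add_distrib]

theorem HasDiv.smul {f : Fin 3 → Pt → ℝ} {g : Pt → ℝ} (c : ℝ) (hf : P.HasDiv f g) :
    P.HasDiv (c • f) (c • g) := by
  obtain ⟨d, hd⟩ := hf
  refine ⟨c • d, fun x hx => ⟨fun a => ((hd x hx).1 a).const_mul c, ?_⟩⟩
  simp [(hd x hx).2, Finset.mul_sum]

theorem HasDiv.eqOn {f : Fin 3 → Pt → ℝ} {g g' : Pt → ℝ} (hg : P.HasDiv f g)
    (hg' : P.HasDiv f g') : EqOn g g' P.Ω := by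
  obtain ⟨d, hd⟩ := hg
  obtain ⟨d', hd'⟩ := hg'
  intro x hx
  rw [(hd x hx).2, (hd' x hx).2]
  exact Finset.sum_congr rfl fun a _ =>
    (uniqueDiffOn_Icc (P.len_pos a) _ (hx a)).eq_deriv _ ((hd x hx).1 a) ((hd' x hx).1 a)

theorem mem_X₂_iff {f : Fin 3 → Pt → ℝ} :
    f ∈ P.X₂ ↔ ∃ h₁ h₂ h₃, P.tensorField h₁ h₂ h₃ = f := by
  simp only [X₂, Submodule.mem_pi, mem_univ, true_implies, Fin.forall_fin_succ,
    IsEmpty.forall_iff, and_true]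
  simp only [cons_val_zero, cons_val_one, cons_val_succ, Fin.succ_zero_eq_one,
    Submodule.mem_span_range_iff_exists_fun]
  constructor
  · rintro ⟨⟨h₁, e₁⟩, ⟨h₂, e₂⟩, ⟨h₃, e₃⟩⟩
    refine ⟨h₁, h₂, h₃, ?_⟩
    funext a x
    fin_cases a
    · simpa [tensorField] using congrFun e₁ x
    · simpa [tensorField] using congrFun e₂ x
    · simpa [tensorField] using congrFun e₃ x
  · rintro ⟨h₁, h₂, h₃, rfl⟩
    refine ⟨⟨h₁, ?_⟩, ⟨h₂, ?_⟩, ⟨h₃, ?_⟩⟩ <;> funext x <;> simp [tensorField]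

theorem mem_X₃_iff {g : Pt → ℝ} : g ∈ P.X₃ ↔ ∃ m, P.tensorFun m = g := by
  rw [X₃, Submodule.mem_span_range_iff_exists_fun]
  refine exists_congr fun m => ?_
  rw [show P.tensorFun m = ∑ a, m a • P.B111 a by funext x; simp [tensorFun]]

theorem mem_V₂_iff {f : Fin 3 → Pt → ℝ} : f ∈ P.V₂ ↔ ∃ h, P.restrictedField h = f := by
  simp only [V₂, Submodule.mem_span_range_iff_exists_fun, restrictedField_eq]

theorem mem_V₃_iff {g : Pt → ℝ} : g ∈ P.V₃ ↔ ∃ m, P.restrictedFun m = g := by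
  simp only [V₃, Submodule.mem_span_range_iff_exists_fun, restrictedFun_eq]

variable (P)

theorem V₂_le_X₂ : P.V₂ ≤ P.X₂ := fun _ hf =>
  let ⟨_, e⟩ := mem_V₂_iff.1 hf
  mem_X₂_iff.2 ⟨_, _, _, e⟩

theorem V₃_le_X₃ : P.V₃ ≤ P.X₃ := fun _ hg =>
  let ⟨_, e⟩ := mem_V₃_iff.1 hg
  mem_X₃_iff.2 ⟨_, e⟩

variable {P}

theorem eq_of_eqOn_Ω {g g' : Pt → ℝ} (hg : g ∈ P.X₃) (hg' : g' ∈ P.X₃) (h : EqOn g g' P.Ω) :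
    g = g' := by
  have key : ∀ g ∈ P.X₃, ∀ x ∉ P.Ω, g x = 0 := by
    intro g hg x hx
    obtain ⟨m, rfl⟩ := mem_X₃_iff.1 hg
    refine Finset.sum_eq_zero fun a _ => ?_
    simp only [Ω, mem_ofPred_eq, not_forall] at hx
    obtain ⟨b, hb⟩ := hx
    fin_cases b
    · simp [B111, show P.kr.Dper a.2.2 (x 0) = 0 from P.kr.Dper_of_notMem _ hb]
    · simp [B111, show P.ks.D a.2.1 (x 1) = 0 from P.ks.D_of_notMem _ hb]
    · simp [B111, show P.kt.Dper a.1 (x 2) = 0 from P.kt.Dper_of_notMem _ hb]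
  funext x
  by_cases hx : x ∈ P.Ω
  · exact h hx
  · rw [key g hg x hx, key g' hg' x hx]

variable (P)

/-- The divergence is a linear operator between the tensor spline spaces. -/
theorem exists_divergence : ∃ δ : P.X₂ →ₗ[ℝ] P.X₃, ∀ f : P.X₂, P.HasDiv f (δ f) := by
  have h1 : ∀ f : P.X₂, ∃ g : P.X₃, P.HasDiv f g := fun ⟨f, hf⟩ => by
    obtain ⟨h₁, h₂, h₃, rfl⟩ := mem_X₂_iff.1 hf
    exact ⟨⟨_, mem_X₃_iff.2 ⟨_, rfl⟩⟩, P.hasDiv_tensorField h₁ h₂ h₃⟩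
  choose δ hδ using h1
  -- Uniqueness of the divergence within `X₃` makes the chosen map linear.
  have uniq : ∀ (f : P.X₂) (g g' : P.X₃), P.HasDiv f g → P.HasDiv f g' → g = g' :=
    fun f g g' hg hg' => Subtype.ext (eq_of_eqOn_Ω g.2 g'.2 (hg.eqOn hg'))
  exact ⟨{ toFun := δ
           map_add' := fun f f' => uniq _ _ _ (hδ _) ((hδ f).add (hδ f'))
           map_smul' := fun c f => uniq _ _ _ (hδ _) ((hδ f).smul c) }, hδ⟩

/-- A right inverse of the polar divergence, which uses poloidal faces only. -/
def polarDivInv : (P.I₃ → ℝ) →ₗ[ℝ] P.I₂ → ℝ where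
  toFun m y := Sum.elim (fun _ => 0) (Sum.elim (fun _ => 0) fun z =>
    if z.2.1 = 1 then -∑ j ∈ Finset.Iic z.1, m (y.1, j, z.2.2) else 0) y.2
  map_add' m m' := by
    funext ⟨k, y⟩
    rcases y with y | y | ⟨j, e, i⟩
    · simp
    · simp
    · by_cases he : e = 1
      · simp [he, Finset.sum_add_distrib, add_comm]
      · simp [he]
  map_smul' c m := by
    funext ⟨k, y⟩
    rcases y with y | y | ⟨j, e, i⟩
    · simp
    · simp
    · by_cases he : e = 1
      · simp [he, Finset.mul_sum]
      · simp [he]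

theorem polarDiv_polarDivInv (m : P.I₃ → ℝ) : P.polarDiv (P.polarDivInv m) = m := by
  funext ⟨k, j, i⟩
  simp only [polarDiv, polarDivInv, LinearMap.coe_mk, AddHom.coe_mk, Sum.elim_inl, Sum.elim_inr,
    zero_ne_one, if_false, if_true, mul_zero, Finset.sum_const_zero, sub_zero, add_zero, zero_sub,
    neg_neg]
  -- Minus the partial sums in `j` telescope to `m`; in the innermost ring the special faces carry
  -- zero, so the sum has one term.
  split_ifs with hj
  · have : Finset.Iic j = {j} := by
      ext a
      simp only [Finset.mem_Iic, Finset.mem_singleton, Fin.le_def, Fin.ext_iff]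
      omega
    simp [this]
  · have hlt : (j : ℕ) - 1 < P.ms := lt_of_le_of_lt (Nat.sub_le _ _) j.isLt
    have : Finset.Iic j = insert j (Finset.Iic ⟨(j : ℕ) - 1, hlt⟩) := by
      ext a
      simp only [Finset.mem_Iic, Finset.mem_insert, Fin.le_def, Fin.ext_iff]
      omega
    rw [this, Finset.sum_insert]
    · ring
    · simp only [Finset.mem_Iic, Fin.le_def]
      omega

/-- The divergence from `V₂` to `V₃` has a linear right inverse. -/
theorem exists_divergence_rightInverse :
    ∃ R : P.V₃ →ₗ[ℝ] P.V₂, ∀ g : P.V₃, P.HasDiv (R g) g := by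
  let A := (Fintype.linearCombination ℝ P.N₂).codRestrict P.V₂ fun h => by
    rw [V₂, ← Fintype.range_linearCombination]
    exact LinearMap.mem_range_self _ _
  let B := (Fintype.linearCombination ℝ P.N₃).codRestrict P.V₃ fun h => by
    rw [V₃, ← Fintype.range_linearCombination]
    exact LinearMap.mem_range_self _ _
  have hB : LinearMap.range B = ⊤ := by
    rw [LinearMap.range_codRestrict, Fintype.range_linearCombination]
    exact Submodule.comap_subtype_self _
  -- A linear choice of coefficients for elements of `V₃`; linear independence of the generators is
  -- not needed.
  obtain ⟨B', hB'⟩ := B.exists_rightInverse_of_surjective hB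
  refine ⟨A ∘ₗ P.polarDivInv ∘ₗ B', fun g => ?_⟩
  have hg : (g : Pt → ℝ) = ∑ l, P.polarDiv (P.polarDivInv (B' g)) l • P.N₃ l := by
    rw [polarDiv_polarDivInv]
    exact congrArg Subtype.val (LinearMap.congr_fun hB' g).symm
  rw [hg]
  exact P.hasDiv_N₂ _

/-- By `restrictedField_eq` the prescribed inputs are exactly the elements of `V₂`, and the
prescribed output is the input. -/
theorem isExtraction₂_iff (ε : P.X₂ →ₗ[ℝ] P.V₂) :
    P.IsExtraction₂ ε ↔ ∀ f : P.X₂, (f : Fin 3 → Pt → ℝ) ∈ P.V₂ →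
      (ε f : Fin 3 → Pt → ℝ) = f := by
  constructor
  · intro hε f hf
    obtain ⟨h, e⟩ := mem_V₂_iff.1 hf
    rw [hε h f e.symm, ← restrictedField_eq, e]
  · intro hε h f e
    rw [← restrictedField_eq, ← e]
    exact hε f (mem_V₂_iff.2 ⟨h, e.symm⟩)

theorem isExtraction₃_iff (ε : P.X₃ →ₗ[ℝ] P.V₃) :
    P.IsExtraction₃ ε ↔ ∀ g : P.X₃, (g : Pt → ℝ) ∈ P.V₃ → (ε g : Pt → ℝ) = g := by
  constructor
  · intro hε f hf
    obtain ⟨h, e⟩ := mem_V₃_iff.1 hf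
    rw [hε h f e.symm, ← restrictedFun_eq, e]
  · intro hε h f e
    rw [← restrictedFun_eq, ← e]
    exact hε f (mem_V₃_iff.2 ⟨h, e.symm⟩)

theorem exists_isExtraction₃ : ∃ ε : P.X₃ →ₗ[ℝ] P.V₃, P.IsExtraction₃ ε := by
  obtain ⟨ε, hε⟩ := (Submodule.inclusion P.V₃_le_X₃).exists_leftInverse_of_injective
    (LinearMap.ker_eq_bot.2 (Submodule.inclusion_injective _))
  refine ⟨ε, (P.isExtraction₃_iff ε).2 fun g hg => ?_⟩
  exact congrArg Subtype.val (LinearMap.congr_fun hε ⟨g, hg⟩)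

theorem exists_isExtraction₂ : ∃ ε : P.X₂ →ₗ[ℝ] P.V₂, P.IsExtraction₂ ε := by
  obtain ⟨ε, hε⟩ := (Submodule.inclusion P.V₂_le_X₂).exists_leftInverse_of_injective
    (LinearMap.ker_eq_bot.2 (Submodule.inclusion_injective _))
  refine ⟨ε, (P.isExtraction₂_iff ε).2 fun g hg => ?_⟩
  exact congrArg Subtype.val (LinearMap.congr_fun hε ⟨g, hg⟩)

/-- Any projection `π` is corrected by a term that vanishes on `V₂` and changes the divergence by
`ε₃ (div (f - π f))`. The total is `div (π f) + ε₃ (div f) - ε₃ (div (π f))`, whose outer terms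
cancel. -/
theorem exists_commuting_extraction (ε₃ : P.X₃ →ₗ[ℝ] P.V₃) (hε₃ : P.IsExtraction₃ ε₃) :
    ∃ ε₂ : P.X₂ →ₗ[ℝ] P.V₂, P.IsExtraction₂ ε₂ ∧
      ∀ (f : P.X₂) (g : P.X₃), P.HasDiv f g → P.HasDiv (ε₂ f) (ε₃ g) := by
  obtain ⟨π, hπ⟩ := P.exists_isExtraction₂
  obtain ⟨δ, hδ⟩ := P.exists_divergence
  obtain ⟨R, hR⟩ := P.exists_divergence_rightInverse
  rw [isExtraction₃_iff] at hε₃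
  rw [isExtraction₂_iff] at hπ
  let ι := Submodule.inclusion P.V₂_le_X₂
  refine ⟨π + R ∘ₗ ε₃ ∘ₗ δ ∘ₗ (LinearMap.id - ι ∘ₗ π), (P.isExtraction₂_iff _).2 fun f hf => ?_,
    fun f g hfg => ?_⟩
  · have h1 : ι (π f) = f := Subtype.ext (hπ f hf)
    simp [h1, hπ f hf]
  · have hg : g = δ f := Subtype.ext (eq_of_eqOn_Ω g.2 (δ f).2 (hfg.eqOn (hδ f)))
    -- The divergence of an element of `V₂` lies in `V₃`, where `ε₃` is the identity.
    have h1 : (ε₃ (δ (ι (π f))) : Pt → ℝ) = δ (ι (π f)) := by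
      refine hε₃ _ ?_
      obtain ⟨h, e⟩ := mem_V₂_iff.1 (π f).2
      have h2 := P.hasDiv_N₂ h
      rw [← restrictedField_eq, ← restrictedFun_eq, e] at h2
      have h3 : P.restrictedFun (P.polarDiv h) ∈ P.V₃ := mem_V₃_iff.2 ⟨_, rfl⟩
      rwa [eq_of_eqOn_Ω (δ (ι (π f))).2 (P.V₃_le_X₃ h3) ((hδ (ι (π f))).eqOn h2)]
    have h4 := (hδ (ι (π f))).add (hR (ε₃ (δ (f - ι (π f)))))
    convert h4 using 1
    · rfl
    · rw [hg, map_sub, map_sub, Submodule.coe_sub, h1, add_sub_cancel]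

end Setting

/-! ### Closed spline curves with control points on the unit circle -/

namespace C1Knots

variable (κ : C1Knots)

/-- The periodic spline with coefficients `c`. -/
def perSpline (c : Fin κ.m → ℝ) (x : ℝ) : ℝ := ∑ i, c i * κ.Bper i x

/-- The derivative of the periodic spline with coefficients `c`. -/
def derivPerSpline (c : Fin κ.m → ℝ) (x : ℝ) : ℝ :=
  ∑ i, (c (finRotate κ.m i) - c i) * κ.Dper i x

theorem hasDerivWithinAt_perSpline (c : Fin κ.m → ℝ) {x : ℝ} (hx : x ∈ Icc 0 κ.L) :
    HasDerivWithinAt (κ.perSpline c) (κ.derivPerSpline c x) (Icc 0 κ.L) x := by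
  refine (HasDerivWithinAt.fun_sum fun i _ =>
    (κ.hasDerivWithinAt_Bper i hx).const_mul (c i)).congr_deriv ?_
  rw [← sum_mulVec_mul (diffPer κ.m) c fun q => κ.Dper q x]
  simp only [mulVec, dotProduct, sum_diffPer_mul, derivPerSpline]

theorem continuousOn_perSpline (c : Fin κ.m → ℝ) : ContinuousOn (κ.perSpline c) (Icc 0 κ.L) :=
  fun _ hx => (κ.hasDerivWithinAt_perSpline c hx).continuousWithinAt

theorem continuousOn_derivPerSpline (c : Fin κ.m → ℝ) :
    ContinuousOn (κ.derivPerSpline c) (Icc 0 κ.L) :=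
  continuousOn_finsetSum _ fun i _ => (κ.continuousOn_Dper i).const_mul _

/-- The representative in `[0, L)` of a point of `[0, L]` with its end points identified. -/
def wrap (x : ℝ) : ℝ := if x = κ.L then 0 else x

theorem wrap_mem {x : ℝ} (hx : x ∈ Icc 0 κ.L) : κ.wrap x ∈ Ico 0 κ.L := by
  unfold wrap
  split_ifs with h
  · exact ⟨le_rfl, κ.L_pos⟩
  · exact ⟨hx.1, lt_of_le_of_ne hx.2 h⟩

theorem Bper_wrap (i : Fin κ.m) (x : ℝ) : κ.Bper i (κ.wrap x) = κ.Bper i x := by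
  unfold wrap
  split_ifs with h
  · rw [h, κ.Bper_L]
  · rfl

theorem Dper_wrap (i : Fin κ.m) (x : ℝ) : κ.Dper i (κ.wrap x) = κ.Dper i x := by
  unfold wrap
  split_ifs with h
  · rw [h, κ.Dper_L]
  · rfl

theorem perSpline_wrap (c : Fin κ.m → ℝ) (x : ℝ) :
    κ.perSpline c (κ.wrap x) = κ.perSpline c x := by
  simp only [perSpline, Bper_wrap]

theorem derivPerSpline_wrap (c : Fin κ.m → ℝ) (x : ℝ) :
    κ.derivPerSpline c (κ.wrap x) = κ.derivPerSpline c x := by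
  simp only [derivPerSpline, Dper_wrap]

/-- The coordinates of the closed spline curve whose control points are equally spaced on the unit
circle. -/
def cosSpline : ℝ → ℝ := κ.perSpline fun i => Real.cos (Setting.angle i)
def sinSpline : ℝ → ℝ := κ.perSpline fun i => Real.sin (Setting.angle i)
def derivCosSpline : ℝ → ℝ := κ.derivPerSpline fun i => Real.cos (Setting.angle i)
def derivSinSpline : ℝ → ℝ := κ.derivPerSpline fun i => Real.sin (Setting.angle i)

/-- The cross product of the position and the velocity of that curve. -/
def wronskian (x : ℝ) : ℝ :=
  κ.cosSpline x * κ.derivSinSpline x - κ.derivCosSpline x * κ.sinSpline x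

theorem continuousOn_wronskian : ContinuousOn κ.wronskian (Icc 0 κ.L) :=
  ((κ.continuousOn_perSpline _).mul (κ.continuousOn_derivPerSpline _)).sub
    ((κ.continuousOn_derivPerSpline _).mul (κ.continuousOn_perSpline _))

theorem wronskian_wrap (x : ℝ) : κ.wronskian (κ.wrap x) = κ.wronskian x := by
  simp only [wronskian, cosSpline, sinSpline, derivCosSpline, derivSinSpline, perSpline_wrap,
    derivPerSpline_wrap]

end C1Knots

namespace Setting

variable (P : Setting)

/-! ### The polar map in closed form -/

/-- The distance from the polar curve as a spline in `s`, and its derivative. -/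
def radial (s : ℝ) : ℝ := ∑ j, P.radius j * P.ks.B j s

def derivRadial (s : ℝ) : ℝ := ∑ l, 1 / ((P.ms : ℝ) + 1) * P.ks.D l s

theorem hasDerivWithinAt_radial {s : ℝ} (hs : s ∈ Icc 0 P.ks.L) :
    HasDerivWithinAt P.radial (P.derivRadial s) (Icc 0 P.ks.L) s := by
  refine (HasDerivWithinAt.fun_sum fun j _ =>
    (P.ks.hasDerivWithinAt_B j hs).const_mul (P.radius j)).congr_deriv ?_
  rw [← sum_mulVec_mul (diff (P.ms + 1)) P.radius fun q => P.ks.D q s]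
  refine Finset.sum_congr rfl fun l _ => ?_
  simp only [mulVec, dotProduct, sum_diff_mul, radius, Fin.val_succ, Fin.val_castSucc]
  rw [← sub_div, Nat.cast_succ, add_sub_cancel_left]

theorem continuousOn_radial : ContinuousOn P.radial (Icc 0 P.ks.L) :=
  fun _ hs => (P.hasDerivWithinAt_radial hs).continuousWithinAt

theorem continuousOn_derivRadial : ContinuousOn P.derivRadial (Icc 0 P.ks.L) :=
  continuousOn_finsetSum _ fun l _ => (P.ks.continuousOn_D l).const_mul _

theorem radial_zero : P.radial 0 = 0 := by
  simp [radial, C1Knots.B_at_zero, radius]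

theorem derivRadial_zero_ne : P.derivRadial 0 ≠ 0 := by
  have h1 := P.ks.one_le_p
  have h2 := P.ks.first_lt
  have h3 : (0 : ℝ) < 1 / ((P.ms : ℝ) + 1) * (P.ks.p / P.ks.t (P.ks.p + 1)) := by positivity
  simpa [derivRadial, C1Knots.D_at_zero] using h3.ne'

theorem sum_Idx (u : Fin P.nt → ℝ) (v : Fin (P.ms + 2) → ℝ) (w : Fin P.nr → ℝ) :
    ∑ a : P.Idx, w a.2.2 * v a.2.1 * u a.1 = (∑ i, w i) * (∑ j, v j) * ∑ k, u k := by
  simp only [Fintype.sum_prod_type, Finset.sum_mul, Finset.mul_sum]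

/-- The polar map in closed form. -/
def polarFormula (r s t : ℝ) : Pt :=
  ![(P.ρ + P.radial s * P.kr.cosSpline r) * P.kt.cosSpline t,
    (P.ρ + P.radial s * P.kr.cosSpline r) * P.kt.sinSpline t,
    P.radial s * P.kr.sinSpline r]

variable {P}

/-- The control points are sums of products of factors in one index each. Partitions of unity remove
the directions on which a summand does not depend; the periodic ones need nonempty bases. -/
theorem F_eq (hr : 0 < P.nr) (ht : 0 < P.nt) {x : Pt} (hx : x ∈ P.Ω) :
    P.F x = P.polarFormula (x 0) (x 1) (x 2) := by
  have h0 := P.kr.sum_Bper hr (hx 0)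
  have h1 := P.ks.sum_B (hx 1)
  have h2 := P.kt.sum_Bper ht (hx 2)
  have key : ∀ c : Fin P.nt → ℝ, ∑ a : P.Idx, P.B000 a x *
      ((P.ρ + P.radius a.2.1 * Real.cos (angle a.2.2)) * c a.1) =
      (P.ρ + P.radial (x 1) * P.kr.cosSpline (x 0)) * P.kt.perSpline c (x 2) := by
    intro c
    have e1 := P.sum_Idx (fun k => c k * P.kt.Bper k (x 2)) (fun j => P.ks.B j (x 1))
      fun i => P.kr.Bper i (x 0)
    have e2 := P.sum_Idx (fun k => c k * P.kt.Bper k (x 2))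
      (fun j => P.radius j * P.ks.B j (x 1)) fun i => Real.cos (angle i) * P.kr.Bper i (x 0)
    rw [h0, h1, one_mul, one_mul] at e1
    have e3 : ∀ a : P.Idx, P.B000 a x *
        ((P.ρ + P.radius a.2.1 * Real.cos (angle a.2.2)) * c a.1) =
        P.ρ * (P.kr.Bper a.2.2 (x 0) * P.ks.B a.2.1 (x 1) * (c a.1 * P.kt.Bper a.1 (x 2))) +
        Real.cos (angle a.2.2) * P.kr.Bper a.2.2 (x 0) * (P.radius a.2.1 * P.ks.B a.2.1 (x 1)) *
          (c a.1 * P.kt.Bper a.1 (x 2)) := fun a => by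
      rw [B000]; ring
    simp only [e3, Finset.sum_add_distrib, ← Finset.mul_sum]
    rw [e1, e2, radial, C1Knots.cosSpline, C1Knots.perSpline, C1Knots.perSpline]
    ring
  funext b
  rw [F, Finset.sum_apply]
  fin_cases b
  · exact key fun k => Real.cos (angle k)
  · exact key fun k => Real.sin (angle k)
  · have e := P.sum_Idx (fun k => P.kt.Bper k (x 2))
      (fun j => P.radius j * P.ks.B j (x 1)) fun i => Real.sin (angle i) * P.kr.Bper i (x 0)
    rw [h2, mul_one] at e
    change ∑ a : P.Idx, P.B000 a x * (P.radius a.2.1 * Real.sin (angle a.2.2)) =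
      P.radial (x 1) * P.kr.sinSpline (x 0)
    rw [mul_comm (P.radial _), C1Knots.sinSpline, radial, C1Knots.perSpline, ← e]
    exact Finset.sum_congr rfl fun a _ => by rw [B000]; ring

theorem DF_eq (hr : 0 < P.nr) (ht : 0 < P.nt) {x : Pt} (hx : x ∈ P.Ω) :
    P.DF x = !![P.radial (x 1) * P.kr.derivCosSpline (x 0) * P.kt.cosSpline (x 2),
        P.derivRadial (x 1) * P.kr.cosSpline (x 0) * P.kt.cosSpline (x 2),
        (P.ρ + P.radial (x 1) * P.kr.cosSpline (x 0)) * P.kt.derivCosSpline (x 2);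
      P.radial (x 1) * P.kr.derivCosSpline (x 0) * P.kt.sinSpline (x 2),
        P.derivRadial (x 1) * P.kr.cosSpline (x 0) * P.kt.sinSpline (x 2),
        (P.ρ + P.radial (x 1) * P.kr.cosSpline (x 0)) * P.kt.derivSinSpline (x 2);
      P.radial (x 1) * P.kr.derivSinSpline (x 0),
        P.derivRadial (x 1) * P.kr.sinSpline (x 0), 0] := by
  have hmem : ∀ a, ∀ y ∈ Icc 0 (P.len a), Function.update x a y ∈ P.Ω := by
    intro a y hy b
    rcases eq_or_ne b a with rfl | hb
    · simpa using hy
    · simpa [hb] using hx b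
  have key : ∀ (a b : Fin 3) (d : ℝ), HasDerivWithinAt
      (fun y => P.polarFormula (Function.update x a y 0) (Function.update x a y 1)
        (Function.update x a y 2) b) d (Icc 0 (P.len a)) (x a) → P.DF x b a = d := by
    intro a b d hd
    have h1 : HasDerivWithinAt (fun y => P.F (Function.update x a y) b) d (Icc 0 (P.len a))
        (x a) := hd.congr (fun y hy => by rw [F_eq hr ht (hmem a y hy)])
      (by rw [F_eq hr ht (hmem a _ (hx a))])
    exact h1.derivWithin (uniqueDiffOn_Icc (P.len_pos a) _ (hx a))
  have hC := P.kr.hasDerivWithinAt_perSpline (fun i => Real.cos (angle i)) (hx 0)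
  have hS := P.kr.hasDerivWithinAt_perSpline (fun i => Real.sin (angle i)) (hx 0)
  have hC' := P.kt.hasDerivWithinAt_perSpline (fun i => Real.cos (angle i)) (hx 2)
  have hS' := P.kt.hasDerivWithinAt_perSpline (fun i => Real.sin (angle i)) (hx 2)
  have hg := P.hasDerivWithinAt_radial (hx 1)
  have k0 : ∀ b d, HasDerivWithinAt (fun y => P.polarFormula y (x 1) (x 2) b) d
      (Icc 0 (P.len 0)) (x 0) → P.DF x b 0 = d := fun b d h => key 0 b d (by simpa using h)
  have k1 : ∀ b d, HasDerivWithinAt (fun y => P.polarFormula (x 0) y (x 2) b) d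
      (Icc 0 (P.len 1)) (x 1) → P.DF x b 1 = d := fun b d h => key 1 b d (by simpa using h)
  have k2 : ∀ b d, HasDerivWithinAt (fun y => P.polarFormula (x 0) (x 1) y b) d
      (Icc 0 (P.len 2)) (x 2) → P.DF x b 2 = d := fun b d h => key 2 b d (by simpa using h)
  ext b a
  fin_cases a <;> fin_cases b
  · exact k0 0 _ (((hC.const_mul _).const_add _).mul_const _)
  · exact k0 1 _ (((hC.const_mul _).const_add _).mul_const _)
  · exact k0 2 _ (hS.const_mul _)
  · exact k1 0 _ (((hg.mul_const _).const_add _).mul_const _)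
  · exact k1 1 _ (((hg.mul_const _).const_add _).mul_const _)
  · exact k1 2 _ (hg.mul_const _)
  · exact k2 0 _ (hC'.const_mul _)
  · exact k2 1 _ (hS'.const_mul _)
  · exact k2 2 _ (hasDerivWithinAt_const _ _ _)

variable (P)

/-- The Jacobian determinant of the polar map, divided by `radial`. -/
def reducedJacobian (x : Pt) : ℝ :=
  P.derivRadial (x 1) * (P.ρ + P.radial (x 1) * P.kr.cosSpline (x 0)) *
    P.kr.wronskian (x 0) * P.kt.wronskian (x 2)

variable {P}

theorem det_DF (hr : 0 < P.nr) (ht : 0 < P.nt) {x : Pt} (hx : x ∈ P.Ω) :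
    (P.DF x).det = P.radial (x 1) * P.reducedJacobian x := by
  rw [DF_eq hr ht hx, det_fin_three]
  simp only [of_apply, cons_val', cons_val_zero, cons_val_one, cons_val, reducedJacobian,
    C1Knots.wronskian]
  ring

theorem continuousOn_reducedJacobian : ContinuousOn P.reducedJacobian P.Ω := by
  have h : ∀ (a : Fin 3) {f : ℝ → ℝ}, ContinuousOn f (Icc 0 (P.len a)) →
      ContinuousOn (fun x : Pt => f (x a)) P.Ω := fun a f hf =>
    hf.comp (continuous_apply a).continuousOn fun x hx => hx a
  exact (((h 1 P.continuousOn_derivRadial).mul (continuousOn_const.add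
    ((h 1 P.continuousOn_radial).mul (h 0 (P.kr.continuousOn_perSpline _))))).mul
    (h 0 P.kr.continuousOn_wronskian)).mul (h 2 P.kt.continuousOn_wronskian)

theorem isCompact_Ω : IsCompact P.Ω := by
  have : P.Ω = Set.pi univ fun a => Icc 0 (P.len a) := by
    ext x
    simp only [Ω, Set.mem_pi, mem_univ, true_implies, mem_ofPred_eq]
  rw [this]
  exact isCompact_univ_pi fun a => isCompact_Icc

/-! ### Periodicity -/

variable (P) in
/-- The representative of a point of `Ω` with opposite sides in the directions `r` and `t`
identified. -/
def wrap (x : Pt) : Pt := ![P.kr.wrap (x 0), x 1, P.kt.wrap (x 2)]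

theorem wrap_mem {x : Pt} (hx : x ∈ P.Ωpos) :
    P.wrap x ∈ {x | x ∈ P.Ωpos ∧ x 0 < P.len 0 ∧ x 2 < P.len 2} := by
  have h0 := P.kr.wrap_mem (hx.1 0)
  have h2 := P.kt.wrap_mem (hx.1 2)
  refine ⟨⟨fun a => ?_, hx.2⟩, h0.2, h2.2⟩
  fin_cases a
  exacts [⟨h0.1, h0.2.le⟩, hx.1 1, ⟨h2.1, h2.2.le⟩]

theorem F_wrap (x : Pt) : P.F (P.wrap x) = P.F x := by
  simp [F, B000, wrap, C1Knots.Bper_wrap]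

theorem N₃_apply (l : P.I₃) (x : Pt) :
    P.N₃ l x = P.kr.Dper l.2.2 (x 0) * P.ks.D l.2.1.succ (x 1) * P.kt.Dper l.1 (x 2) := by
  simp [N₃, E111, E2, B111, Fintype.sum_prod_type, one_apply, ite_and]

theorem N₃_wrap (l : P.I₃) (x : Pt) : P.N₃ l (P.wrap x) = P.N₃ l x := by
  simp [N₃_apply, wrap, C1Knots.Dper_wrap]

theorem reducedJacobian_wrap (x : Pt) : P.reducedJacobian (P.wrap x) = P.reducedJacobian x := by
  simp [reducedJacobian, wrap, C1Knots.wronskian_wrap, C1Knots.cosSpline, C1Knots.perSpline_wrap]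

/-- Two preimages of a point become equal after wrapping, by injectivity, so they share `s`, hence
`radial`; the remaining factors are invariant under wrapping. -/
theorem pushforward₃_N₃ (hreg : P.IsRegular) (l : P.I₃) {x : Pt} (hx : x ∈ P.Ωpos) :
    P.pushforward₃ (P.N₃ l) (P.F x) = ((P.DF x).det)⁻¹ * P.N₃ l x := by
  have hr : 0 < P.nr := l.2.2.pos
  have ht : 0 < P.nt := l.1.pos
  have hex : ∃ a ∈ P.Ωpos, P.F a = P.F x := ⟨x, hx, rfl⟩
  unfold pushforward₃
  have hx' := Function.invFunOn_mem hex
  have hF := Function.invFunOn_eq hex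
  generalize Function.invFunOn P.F P.Ωpos (P.F x) = x' at hx' hF
  have hw : P.wrap x' = P.wrap x :=
    hreg.1 (wrap_mem hx') (wrap_mem hx) (by rw [F_wrap, F_wrap, hF])
  have h1 : x' 1 = x 1 := congrFun hw 1
  rw [det_DF hr ht hx'.1, det_DF hr ht hx.1, h1, ← reducedJacobian_wrap x', ← N₃_wrap l x', hw,
    reducedJacobian_wrap, N₃_wrap]

/-! ### Boundedness of the pushforwards -/

/-- For `s > 0` this is regularity. At `s = 0` the two wronskians do not depend on `s` and are
nonzero by comparison with `s = S`, while the other factors are the initial slope of `radial` and `ρ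
> 2`. -/
theorem reducedJacobian_ne_zero (hr : 0 < P.nr) (ht : 0 < P.nt) (hreg : P.IsRegular) {x : Pt}
    (hx : x ∈ P.Ω) : P.reducedJacobian x ≠ 0 := by
  have hpos : ∀ y ∈ P.Ωpos, P.reducedJacobian y ≠ 0 := fun y hy =>
    right_ne_zero_of_mul (det_DF hr ht hy.1 ▸ hreg.2 y hy)
  rcases (hx 1).1.eq_or_lt with h | h
  · have hS := P.ks.L_pos
    have hy := hpos (Function.update x 1 P.ks.L) ⟨fun b => by
      rcases eq_or_ne b 1 with rfl | hb
      · simpa using ⟨hS.le, le_rfl⟩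
      · simpa [hb] using hx b, by simpa using hS⟩
    simp only [reducedJacobian, mul_ne_zero_iff, Function.update_self, Function.update_of_ne, ne_eq,
      Fin.reduceEq, not_false_eq_true] at hy
    simp only [reducedJacobian, mul_ne_zero_iff, ← h, P.radial_zero, zero_mul, add_zero]
    exact ⟨⟨⟨P.derivRadial_zero_ne, by linarith [P.two_lt]⟩, hy.1.2⟩, hy.2⟩
  · exact hpos x ⟨hx, h⟩

theorem exists_pos_le_abs {X : Type*} [TopologicalSpace X] {s : Set X} (hs : IsCompact s)
    {f : X → ℝ} (hf : ContinuousOn f s) (h0 : ∀ x ∈ s, f x ≠ 0) :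
    ∃ c > 0, ∀ x ∈ s, c ≤ |f x| := by
  rcases s.eq_empty_or_nonempty with rfl | hne
  · exact ⟨1, one_pos, by simp⟩
  · obtain ⟨x, hx, hmin⟩ := hs.exists_isMinOn hne hf.abs
    exact ⟨|f x|, abs_pos.2 (h0 x hx), fun y hy => hmin hy⟩

theorem exists_mul_le_abs_radial (hr : 0 < P.nr) (ht : 0 < P.nt) (hreg : P.IsRegular) :
    ∃ c > 0, ∀ s ∈ Icc 0 P.ks.L, c * s ≤ |P.radial s| := by
  have h0 : ∀ s ∈ Icc 0 P.ks.L, P.derivRadial s ≠ 0 := fun s hs => by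
    have := reducedJacobian_ne_zero hr ht hreg (x := Function.update 0 1 s) fun b => by
      rcases eq_or_ne b 1 with rfl | hb
      · simpa using (show s ∈ Icc 0 (P.len 1) from hs)
      · simpa [hb] using (P.len_pos b).le
    simp only [reducedJacobian, mul_ne_zero_iff, Function.update_self] at this
    exact this.1.1.1
  -- The slope of `radial` is bounded away from zero, and the mean value theorem on `[0, s]`
  -- transfers the bound.
  obtain ⟨c, hc, hle⟩ := exists_pos_le_abs isCompact_Icc P.continuousOn_derivRadial h0
  refine ⟨c, hc, fun s hs => ?_⟩
  rcases hs.1.eq_or_lt with rfl | hpos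
  · simp
  · obtain ⟨ξ, hξ, e⟩ := exists_hasDerivAt_eq_slope P.radial P.derivRadial hpos
      (P.continuousOn_radial.mono (Icc_subset_Icc_right hs.2)) fun y hy =>
        (P.hasDerivWithinAt_radial ⟨hy.1.le, hy.2.le.trans hs.2⟩).hasDerivAt
          (Icc_mem_nhds hy.1 (hy.2.trans_le hs.2))
    rw [P.radial_zero, sub_zero, sub_zero, eq_div_iff hpos.ne'] at e
    rw [← e, abs_mul, abs_of_pos hpos]
    exact mul_le_mul_of_nonneg_right (hle ξ ⟨hξ.1.le, hξ.2.le.trans hs.2⟩) hpos.le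

theorem exists_abs_N₃_le (l : P.I₃) : ∃ M, ∀ x ∈ P.Ω, |P.N₃ l x| ≤ M * x 1 := by
  obtain ⟨M₀, h₀⟩ := isCompact_Icc.exists_bound_of_continuousOn (P.kr.continuousOn_Dper l.2.2)
  -- Only successor indices occur in the direction `s`, which yields the factor `x 1`.
  obtain ⟨M₁, h₁⟩ := P.ks.exists_abs_D_le_mul (Fin.succ_ne_zero l.2.1)
  obtain ⟨M₂, h₂⟩ := isCompact_Icc.exists_bound_of_continuousOn (P.kt.continuousOn_Dper l.1)
  refine ⟨M₀ * M₁ * M₂, fun x hx => ?_⟩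
  have e₀ : |P.kr.Dper l.2.2 (x 0)| ≤ M₀ := h₀ _ (hx 0)
  have e₁ := h₁ _ (hx 1)
  have e₂ : |P.kt.Dper l.1 (x 2)| ≤ M₂ := h₂ _ (hx 2)
  rw [N₃_apply, abs_mul, abs_mul]
  calc _ ≤ M₀ * (M₁ * x 1) * M₂ := by
        have n₀ := (abs_nonneg _).trans e₀
        have n₁ := (abs_nonneg _).trans e₁
        gcongr
    _ = _ := by ring

theorem exists_abs_pushforward₃_le (hreg : P.IsRegular) (l : P.I₃) :
    ∃ M : ℝ, ∀ y ∈ P.F '' P.Ωpos, |P.pushforward₃ (P.N₃ l) y| ≤ M := by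
  have hr : 0 < P.nr := l.2.2.pos
  have ht : 0 < P.nt := l.1.pos
  obtain ⟨c, hc, h₁⟩ := exists_mul_le_abs_radial hr ht hreg
  obtain ⟨c', hc', h₂⟩ := exists_pos_le_abs isCompact_Ω continuousOn_reducedJacobian
    fun x hx => reducedJacobian_ne_zero hr ht hreg hx
  obtain ⟨M, hM⟩ := exists_abs_N₃_le l
  refine ⟨M / (c * c'), ?_⟩
  rintro _ ⟨x, hx, rfl⟩
  rw [pushforward₃_N₃ hreg l hx, det_DF hr ht hx.1, abs_mul, abs_inv, abs_mul, ← div_eq_inv_mul]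
  have hs : 0 < x 1 := hx.2
  calc |P.N₃ l x| / (|P.radial (x 1)| * |P.reducedJacobian x|)
      ≤ M * x 1 / (c * x 1 * c') := by
        have n := (abs_nonneg _).trans (hM x hx.1)
        have := hM x hx.1
        have := h₁ _ (hx.1 1)
        have := h₂ x hx.1
        gcongr
    _ = M / (c * c') := by field_simp

end Setting

end PolarSplines

end

theorem mainTheorem7 (P : PolarSplines.Setting) :
    -- the divergence of a tensor spline field, through its degrees of freedom
    (∀ (h₁ : P.Idx' → ℝ) (h₂ : P.Idx → ℝ) (h₃ : P.Idx' → ℝ),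
      P.HasDiv (P.tensorField h₁ h₂ h₃)
        (P.tensorFun (P.D100 *ᵥ h₁ + P.D010 *ᵥ h₂ + P.D001 *ᵥ h₃))) ∧
    -- the square of degrees of freedom commutes
    (∀ h : P.I₂ → ℝ,
      P.D100 *ᵥ (P.E011ᵀ *ᵥ h) + P.D010 *ᵥ (P.E101ᵀ *ᵥ h) + P.D001 *ᵥ (P.E110ᵀ *ᵥ h) =
        P.E111ᵀ *ᵥ P.polarDiv h) ∧
    -- the divergence maps `V₂` to `V₃`, compatibly with the tensor spaces
    (∀ h : P.I₂ → ℝ,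
      P.restrictedField h = ∑ l, h l • P.N₂ l ∧
      P.restrictedFun (P.polarDiv h) = ∑ l, P.polarDiv h l • P.N₃ l ∧
      P.HasDiv (∑ l, h l • P.N₂ l) (∑ l, P.polarDiv h l • P.N₃ l)) ∧
    -- the square of extraction operators and divergences commutes on the full tensor spaces
    (∃ ε₃ : P.X₃ →ₗ[ℝ] P.V₃, P.IsExtraction₃ ε₃) ∧
    (∀ ε₃ : P.X₃ →ₗ[ℝ] P.V₃, P.IsExtraction₃ ε₃ →
      ∃ ε₂ : P.X₂ →ₗ[ℝ] P.V₂, P.IsExtraction₂ ε₂ ∧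
        ∀ (f : P.X₂) (g : P.X₃), P.HasDiv f g → P.HasDiv (ε₂ f) (ε₃ g)) ∧
    -- the pushforwards of the basis functions of `V₃` are well defined and bounded
    (P.IsRegular → ∀ l : P.I₃,
      (∀ x ∈ P.Ωpos, P.pushforward₃ (P.N₃ l) (P.F x) = ((P.DF x).det)⁻¹ * P.N₃ l x) ∧
      ∃ M : ℝ, ∀ y ∈ P.F '' P.Ωpos, |P.pushforward₃ (P.N₃ l) y| ≤ M) := by
  exact ⟨P.hasDiv_tensorField, P.coefficients_commute,
    fun h => ⟨P.restrictedField_eq h, P.restrictedFun_eq _, P.hasDiv_N₂ h⟩,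
    P.exists_isExtraction₃, P.exists_commuting_extraction,
    fun hreg l => ⟨fun _ hx => PolarSplines.Setting.pushforward₃_N₃ hreg l hx,
      PolarSplines.Setting.exists_abs_pushforward₃_le hreg l⟩⟩
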